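/- Let $d\ge 4$, and let $\mathcal D^2$ be the Laplacian on the round unit sphere $S^{d-2}$. On $d$-dimensional Minkowski spacetime with retarded time $u=t-r$ and angles $x\in S^{d-2}$, consider formal $1/r$ expansions with smooth coefficients on $\mathbb R\times S^{d-2}$: a source $S\sim\sum_{n\ge d-2} r^{-n}S^{(n)}(u,x)$ ($n$ integer), and a scalar field $$\phi\sim\sum_{n\ge d/2-1} r^{-n}\phi^{(n)}(u,x)\quad (d \text{ even}),\qquad \phi\sim\sum_{n\ge d/2-1} r^{-n}\phi^{(n)}(u,x)+\sum_{p\ge d-3} r^{-p}\tilde\phi^{(p)}(u,x)\quad (d\text{ odd}),$$ where $n$ runs in integer steps upward from $d/2-1$ (so over integers for $d$ even and half-integers for $d$ odd), $p$ runs over integers, and coefficients at orders not occurring in a sum are zero. If $d=4$, assume $S^{(2)}=0$. Fix $u_0\in\mathbb R$. The equation $\Box\phi=S$ gives the recursion relations $$[\mathcal D^2+(n-1)(n-d+2)]\phi^{(n-1)}+(2n-d+2)\,\partial_u\phi^{(n)}=\sigma^{(n+1)},\qquad n\ge d/2-1,\tag{1}$$ with $\sigma^{(n+1)}=S^{(n+1)}$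 for $d$ even and $\sigma^{(n+1)}=0$ for $d$ odd, and, for $d$ odd, in addition $$[\mathcal D^2+(p-1)(p-d+2)]\tilde\phi^{(p-1)}+(2p-d+2)\,\partial_u\tilde\phi^{(p)}=S^{(p+1)},\qquad p\ge d-3.\tag{2}$$ (a) Let $d$ be even. For every integer $n$ with $1<n\le d-3$, the operator $\mathcal D^2+(n-1)(n-d+2)$ is a bijection of $C^\infty(S^{d-2})$ onto itself. For every smooth function $\phi_C(u,x)$ and all smooth functions $\phi_0^{(n)}(x)$, $n>d-3$, there is exactly one solution $(\phi^{(n)})$ of (1) with $\phi^{(d-3)}=\phi_C$ (Coulombic order) and $\phi^{(n)}(u_0,x)=\phi^{(n)}_0(x)$ for all $n>d-3$. (b) Let $d$ be odd. For every half-integer $n\in\mathbb Z+\tfrac12$, the operator $\mathcal D^2+(n-1)(n-d+2)$ is a bijection of $C^\infty(S^{d-2})$ onto itself. For every half-integer $n_0\ge d/2-1$, every smooth function $\psi(u,x)$, all smooth functions $\phi_0^{(n)}(x)$ for half-integers $n>n_0$, and all smooth functions $\tilde\phi_0^{(p)}(x)$ for integers $p\ge d-3$, there is exactly one solution $(\phi^{(n)}),(\tilde\phi^{(p)})$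 of (1) and (2) with $\phi^{(n_0)}=\psi$, $\phi^{(n)}(u_0,x)=\phi_0^{(n)}(x)$ for all $n>n_0$, and $\tilde\phi^{(p)}(u_0,x)=\tilde\phi_0^{(p)}(x)$ for all $p\ge d-3$. -/

import Mathlib

open scoped Manifold ContDiff

noncomputable section

/-- The unit `(d-2)`-sphere in `ℝ^{d-1}` (for `d ≥ 2` one has `d - 2 + 1 = d - 1`). -/
abbrev CelestialSphere (d : ℕ) : Type :=
  Metric.sphere (0 : EuclideanSpace ℝ (Fin (d - 2 + 1))) 1

/-- Smooth real functions `f(x)` on the unit `(d-2)`-sphere. -/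
abbrev SphereFunction (d : ℕ) : Type :=
  C^∞⟮𝓡 (d - 2), CelestialSphere d; 𝓘(ℝ, ℝ), ℝ⟯

/-- Smooth real functions `f(u, x)` of retarded time `u ∈ ℝ` and the angle `x ∈ S^{d-2}`. -/
abbrev ScriFunction (d : ℕ) : Type :=
  C^∞⟮(𝓘(ℝ, ℝ)).prod (𝓡 (d - 2)), ℝ × CelestialSphere d; 𝓘(ℝ, ℝ), ℝ⟯

open Classical in
/-- The extension of a function on the unit sphere to `ℝ^{d-1} ∖ {0}` that is constant along rays
(with value `0` at the origin). -/
def radialExtension {d : ℕ} (f : CelestialSphere d → ℝ)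
    (y : EuclideanSpace ℝ (Fin (d - 2 + 1))) : ℝ :=
  if hy : y = 0 then 0
  else f ⟨‖y‖⁻¹ • y, by
    rw [mem_sphere_zero_iff_norm, norm_smul, norm_inv, norm_norm,
      inv_mul_cancel₀ (norm_ne_zero_iff.mpr hy)]⟩

/-- The Laplacian `𝒟²` of the round unit `(d-2)`-sphere.
Since `Δ = ∂_r² + ((d-2)/r) ∂_r + r⁻² 𝒟²` on `ℝ^{d-1}`, it is the restriction to the sphere of
the Euclidean Laplacian of the extension that is constant along rays. -/
def sphereLaplacian {d : ℕ} (f : CelestialSphere d → ℝ) (x : CelestialSphere d) : ℝ :=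
  Laplacian.laplacian (radialExtension f) (x : EuclideanSpace ℝ (Fin (d - 2 + 1)))

/-- The angular operator `𝒟² + (n-1)(n-d+2)`. -/
def angularOperator (d : ℕ) (n : ℚ) (f : CelestialSphere d → ℝ) (x : CelestialSphere d) : ℝ :=
  sphereLaplacian f x + (((n - 1) * (n - d + 2) : ℚ) : ℝ) * f x

/-- `𝒟² + (n-1)(n-d+2)` is invertible as an operator on smooth functions on the sphere. -/
def AngularOperatorInvertible (d : ℕ) (n : ℚ) : Prop :=
  ∀ g : SphereFunction d, ∃! f : SphereFunction d, ∀ x, angularOperator d n f x = g x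

/-- The orders `n = d/2 - 1, d/2, d/2 + 1, …`, starting at radiative order
(integers for even `d`, half-integers for odd `d`). -/
def radiativeOrders (d : ℕ) : Set ℚ := {n | ∃ j : ℕ, n = (d : ℚ) / 2 - 1 + j}

/-- The integer orders `p = d - 3, d - 2, …`, starting at Coulombic order. -/
def coulombicOrders (d : ℕ) : Set ℚ := {p | ∃ j : ℕ, p = (d : ℚ) - 3 + j}

/-- The integer orders `n = d - 2, d - 1, …` of the source. -/
def sourceOrders (d : ℕ) : Set ℚ := {n | ∃ j : ℕ, n = (d : ℚ) - 2 + j}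

/-- The coefficient family `a` is that of a formal expansion `∑_{n ∈ N} a⁽ⁿ⁾(u, x) / rⁿ`:
the coefficients at all orders outside `N` vanish. -/
def IsExpansion {d : ℕ} (N : Set ℚ) (a : ℚ → ScriFunction d) : Prop :=
  ∀ n, n ∉ N → a n = 0

/-- The recursion relation at order `n`:
`[𝒟² + (n-1)(n-d+2)] φ⁽ⁿ⁻¹⁾ + (2n-d+2) ∂_u φ⁽ⁿ⁾ = S⁽ⁿ⁺¹⁾`. -/
def RecursionAt {d : ℕ} (φ S : ℚ → ScriFunction d) (n : ℚ) : Prop :=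
  ∀ (u : ℝ) (x : CelestialSphere d),
    angularOperator d n (fun y => φ (n - 1) (u, y)) x
      + ((2 * n - d + 2 : ℚ) : ℝ) * deriv (fun v : ℝ => φ n (v, x)) u = S (n + 1) (u, x)

end

/-
Identify a function on the sphere with its extension of degree `α` to `ℝ^{d-1} ∖ {0}`: for
`α = 1 - n` or `α = n - d + 2` the angular operator `𝒟² + (n-1)(n-d+2) = 𝒟² + α(α+d-3)` becomes
the Euclidean Laplacian on homogeneous functions of degree `α`. For `3 - d < α < 0` its kernel is
trivial by the maximum principle, and the Newton potential of a source of degree `α - 2` converges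
and solves Poisson's equation. Solvability passes from degree `α - 1` to degree `α`, because the
partial derivatives of a solution of degree `α` solve equations of degree `α - 1` and recover it
through Euler's identity; starting in that range this reaches every half-integer order. The
recursion is then solved downwards from the prescribed coefficient by inverting the angular
operator and upwards by integrating in `u`, the factor `2n - d + 2` vanishing only at radiative
order, where the relation is empty because the source and the preceding coefficient vanish.
-/

open MeasureTheory Filter Topology

section DirectionalDerivatives

variable {V W : Type*} [NormedAddCommGroup V] [NormedSpace ℝ V] [NormedAddCommGroup W]
  [NormedSpace ℝ W] {U : Set V} {F G : V → ℝ} {p : V}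

/-- The derivative of `F` in the constant direction `v`, as a function of the base point. -/
noncomputable def dirDeriv (v : V) (F : V → ℝ) : V → ℝ := fun p => fderiv ℝ F p v

lemma differentiableAt_of_contDiffOn (hF : ContDiffOn ℝ ∞ F U) (hU : IsOpen U) (hp : p ∈ U) :
    DifferentiableAt ℝ F p :=
  (hF.contDiffAt (hU.mem_nhds hp)).differentiableAt (by simp)

lemma contDiffOn_dirDeriv (hF : ContDiffOn ℝ ∞ F U) (hU : IsOpen U) (v : V) :
    ContDiffOn ℝ ∞ (dirDeriv v F) U :=
  (hF.fderiv_of_isOpen hU (by simp)).clm_apply contDiffOn_const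

lemma contDiff_dirDeriv (hF : ContDiff ℝ ∞ F) (v : V) : ContDiff ℝ ∞ (dirDeriv v F) :=
  contDiffOn_univ.mp (contDiffOn_dirDeriv hF.contDiffOn isOpen_univ v)

lemma dirDeriv_congr (hU : IsOpen U) (h : Set.EqOn F G U) (v : V) :
    Set.EqOn (dirDeriv v F) (dirDeriv v G) U := fun p hp => by
  simp only [dirDeriv, (eventuallyEq_of_mem (hU.mem_nhds hp) h).fderiv_eq]

lemma dirDeriv_const (v : V) (c : ℝ) : dirDeriv v (fun _ => c) = fun _ => 0 := by
  ext p
  simp [dirDeriv]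

lemma dirDeriv_comp {g : W → V} {g' : W →L[ℝ] V} {q : W} (hF : DifferentiableAt ℝ F (g q))
    (hg : HasFDerivAt g g' q) (w : W) :
    dirDeriv w (fun r => F (g r)) q = dirDeriv (g' w) F (g q) :=
  congrArg (· w) (hF.hasFDerivAt.comp q hg).fderiv

lemma dirDeriv_const_mul (c : ℝ) (F : V → ℝ) (v : V) :
    dirDeriv v (fun q => c * F q) = fun q => c * dirDeriv v F q := by
  ext p
  change fderiv ℝ (c • F) p v = c * fderiv ℝ F p v
  rw [fderiv_const_smul_field]
  rfl

lemma dirDeriv_sub (hF : DifferentiableAt ℝ F p) (hG : DifferentiableAt ℝ G p) (v : V) :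
    dirDeriv v (fun q => F q - G q) p = dirDeriv v F p - dirDeriv v G p := by
  simp [dirDeriv, fderiv_fun_sub hF hG]

lemma dirDeriv_add (hF : DifferentiableAt ℝ F p) (hG : DifferentiableAt ℝ G p) (v : V) :
    dirDeriv v (fun q => F q + G q) p = dirDeriv v F p + dirDeriv v G p := by
  simp [dirDeriv, fderiv_fun_add hF hG]

lemma dirDeriv_sum {κ : Type*} (s : Finset κ) {H : κ → V → ℝ}
    (hH : ∀ k ∈ s, DifferentiableAt ℝ (H k) p) (v : V) :
    dirDeriv v (fun q => ∑ k ∈ s, H k q) p = ∑ k ∈ s, dirDeriv v (H k) p := by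
  simp [dirDeriv, fderiv_fun_sum hH]

lemma dirDeriv_mul (hF : DifferentiableAt ℝ F p) (hG : DifferentiableAt ℝ G p) (v : V) :
    dirDeriv v (fun q => F q * G q) p = F p * dirDeriv v G p + G p * dirDeriv v F p := by
  simp [dirDeriv, fderiv_fun_mul hF hG]

lemma dirDeriv_dirDeriv_eq_fderiv_fderiv (hF : ContDiffAt ℝ 2 F p) (v w : V) :
    dirDeriv v (dirDeriv w F) p = fderiv ℝ (fderiv ℝ F) p v w := by
  have hd : DifferentiableAt ℝ (fderiv ℝ F) p :=
    (hF.fderiv_right (m := 1) (by norm_num)).differentiableAt (by simp)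
  unfold dirDeriv
  rw [fderiv_clm_apply hd (differentiableAt_const _)]
  simp

lemma dirDeriv_comm (hF : ContDiffAt ℝ 2 F p) (v w : V) :
    dirDeriv v (dirDeriv w F) p = dirDeriv w (dirDeriv v F) p := by
  rw [dirDeriv_dirDeriv_eq_fderiv_fderiv hF, dirDeriv_dirDeriv_eq_fderiv_fderiv hF,
    (hF.isSymmSndFDerivAt (by simp)).eq]

end DirectionalDerivatives

section LaplacianAlong

variable {V : Type*} [NormedAddCommGroup V] [NormedSpace ℝ V] {ι : Type*} [Fintype ι] (e : ι → V)
  {U : Set V} {F G : V → ℝ} {p : V}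

/-- The second-order operator `∑ᵢ ∂_{eᵢ}²`. For an orthonormal basis `e` it is the Laplacian;
allowing an arbitrary family of directions also covers the Laplacian in one factor of a product. -/
noncomputable def laplacianAlong (F : V → ℝ) : V → ℝ :=
  fun p => ∑ i, dirDeriv (e i) (dirDeriv (e i) F) p

lemma contDiffOn_laplacianAlong (hF : ContDiffOn ℝ ∞ F U) (hU : IsOpen U) :
    ContDiffOn ℝ ∞ (laplacianAlong e F) U :=
  ContDiffOn.sum fun _ _ => contDiffOn_dirDeriv (contDiffOn_dirDeriv hF hU _) hU _

lemma contDiff_laplacianAlong (hF : ContDiff ℝ ∞ F) : ContDiff ℝ ∞ (laplacianAlong e F) :=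
  contDiffOn_univ.mp (contDiffOn_laplacianAlong e hF.contDiffOn isOpen_univ)

lemma laplacianAlong_congr (hU : IsOpen U) (h : Set.EqOn F G U) :
    Set.EqOn (laplacianAlong e F) (laplacianAlong e G) U := fun _ hp =>
  Finset.sum_congr rfl fun _ _ => dirDeriv_congr hU (dirDeriv_congr hU h _) _ hp

lemma laplacianAlong_const_mul (c : ℝ) (F : V → ℝ) (p : V) :
    laplacianAlong e (fun q => c * F q) p = c * laplacianAlong e F p := by
  simp only [laplacianAlong, dirDeriv_const_mul, Finset.mul_sum]

lemma laplacianAlong_sub (hF : ContDiffOn ℝ ∞ F U) (hG : ContDiffOn ℝ ∞ G U) (hU : IsOpen U)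
    (hp : p ∈ U) :
    laplacianAlong e (fun q => F q - G q) p = laplacianAlong e F p - laplacianAlong e G p := by
  simp only [laplacianAlong, ← Finset.sum_sub_distrib]
  refine Finset.sum_congr rfl fun i _ => ?_
  rw [dirDeriv_congr hU (fun q hq => dirDeriv_sub (differentiableAt_of_contDiffOn hF hU hq)
    (differentiableAt_of_contDiffOn hG hU hq) (e i)) _ hp]
  exact dirDeriv_sub (differentiableAt_of_contDiffOn (contDiffOn_dirDeriv hF hU _) hU hp)
    (differentiableAt_of_contDiffOn (contDiffOn_dirDeriv hG hU _) hU hp) _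

lemma laplacianAlong_sum {κ : Type*} (s : Finset κ) {H : κ → V → ℝ}
    (hH : ∀ k ∈ s, ContDiffOn ℝ ∞ (H k) U) (hU : IsOpen U) (hp : p ∈ U) :
    laplacianAlong e (fun q => ∑ k ∈ s, H k q) p = ∑ k ∈ s, laplacianAlong e (H k) p := by
  simp only [laplacianAlong]
  rw [Finset.sum_comm]
  refine Finset.sum_congr rfl fun i _ => ?_
  rw [dirDeriv_congr hU (fun q hq => dirDeriv_sum s
    (fun k hk => differentiableAt_of_contDiffOn (hH k hk) hU hq) (e i)) _ hp]
  exact dirDeriv_sum s (fun k hk =>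
    differentiableAt_of_contDiffOn (contDiffOn_dirDeriv (hH k hk) hU _) hU hp) _

lemma laplacianAlong_mul (hF : ContDiffOn ℝ ∞ F U) (hG : ContDiffOn ℝ ∞ G U) (hU : IsOpen U)
    (hp : p ∈ U) :
    laplacianAlong e (fun q => F q * G q) p = F p * laplacianAlong e G p
      + 2 * ∑ i, dirDeriv (e i) F p * dirDeriv (e i) G p + G p * laplacianAlong e F p := by
  simp only [laplacianAlong, Finset.mul_sum, ← Finset.sum_add_distrib]
  refine Finset.sum_congr rfl fun i _ => ?_
  have dF := differentiableAt_of_contDiffOn hF hU hp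
  have dG := differentiableAt_of_contDiffOn hG hU hp
  have dF' := differentiableAt_of_contDiffOn (contDiffOn_dirDeriv hF hU (e i)) hU hp
  have dG' := differentiableAt_of_contDiffOn (contDiffOn_dirDeriv hG hU (e i)) hU hp
  rw [dirDeriv_congr hU (fun q hq => dirDeriv_mul (differentiableAt_of_contDiffOn hF hU hq)
      (differentiableAt_of_contDiffOn hG hU hq) (e i)) _ hp,
    dirDeriv_add (dF.fun_mul dG') (dG.fun_mul dF'), dirDeriv_mul dF dG', dirDeriv_mul dG dF']
  ring

lemma laplacianAlong_dirDeriv (hF : ContDiffOn ℝ ∞ F U) (hU : IsOpen U) (v : V) (hp : p ∈ U) :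
    laplacianAlong e (dirDeriv v F) p = dirDeriv v (laplacianAlong e F) p := by
  have hcomm {H : V → ℝ} (hH : ContDiffOn ℝ ∞ H U) (i : ι) {q : V} (hq : q ∈ U) :
      dirDeriv (e i) (dirDeriv v H) q = dirDeriv v (dirDeriv (e i) H) q :=
    dirDeriv_comm ((hH.contDiffAt (hU.mem_nhds hq)).of_le (WithTop.coe_le_coe.mpr le_top)) _ _
  have hF' := fun i => contDiffOn_dirDeriv hF hU (e i)
  calc laplacianAlong e (dirDeriv v F) p
      = ∑ i, dirDeriv v (dirDeriv (e i) (dirDeriv (e i) F)) p :=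
        Finset.sum_congr rfl fun i _ => by
          rw [dirDeriv_congr hU (fun q hq => hcomm hF i hq) _ hp, hcomm (hF' i) i hp]
    _ = dirDeriv v (laplacianAlong e F) p :=
        (dirDeriv_sum _ (fun i _ =>
          differentiableAt_of_contDiffOn (contDiffOn_dirDeriv (hF' i) hU _) hU hp) v).symm

lemma laplacianAlong_comp_add_right (h : V → ℝ) (y x : V) :
    laplacianAlong e (fun z => h (z + y)) x = laplacianAlong e h (x + y) := by
  have (g : V → ℝ) (v : V) : dirDeriv v (fun z => g (z + y)) = fun z => dirDeriv v g (z + y) :=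
    funext fun z => by simp only [dirDeriv, fderiv_comp_add_right]
  simp only [laplacianAlong, this]

lemma tsupport_dirDeriv_subset (h : V → ℝ) (v : V) : tsupport (dirDeriv v h) ⊆ tsupport h :=
  tsupport_fderiv_apply_subset ℝ v

lemma tsupport_laplacianAlong_subset (h : V → ℝ) :
    tsupport (laplacianAlong e h) ⊆ tsupport h :=
  closure_minimal (fun x hx => by
    by_contra hn
    exact hx (Finset.sum_eq_zero fun i _ => image_eq_zero_of_notMem_tsupport fun hm =>
      hn (tsupport_dirDeriv_subset _ _ (tsupport_dirDeriv_subset _ _ hm)))) (isClosed_tsupport h)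

lemma deriv_deriv_nonneg_of_isLocalMin {f : ℝ → ℝ} {a : ℝ} (hmin : IsLocalMin f a)
    (hf : ContinuousAt f a) : 0 ≤ deriv (deriv f) a := by
  by_contra! hneg
  have hmax : IsLocalMax f a := isLocalMax_of_deriv_deriv_neg hneg hmin.deriv_eq_zero hf
  have hconst : f =ᶠ[𝓝 a] fun _ => f a := by
    filter_upwards [hmax, hmin] with t ha hb using le_antisymm ha hb
  have : deriv f =ᶠ[𝓝 a] fun _ => 0 := by simpa using hconst.deriv
  simp [this.deriv_eq] at hneg

lemma deriv_deriv_line_eq_dirDeriv_dirDeriv (hF : ContDiffOn ℝ ∞ F U) (hU : IsOpen U)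
    (hp : p ∈ U) (v : V) :
    deriv (deriv fun t : ℝ => F (p + t • v)) 0 = dirDeriv v (dirDeriv v F) p := by
  have hline (t : ℝ) : HasDerivAt (fun t : ℝ => p + t • v) v t := by
    simpa using ((hasDerivAt_id t).smul_const v).const_add p
  have hderiv {H : V → ℝ} (hH : ContDiffOn ℝ ∞ H U) {t : ℝ} (ht : p + t • v ∈ U) :
      deriv (fun t : ℝ => H (p + t • v)) t = dirDeriv v H (p + t • v) :=
    ((differentiableAt_of_contDiffOn hH hU ht).hasFDerivAt.comp_hasDerivAt t (hline t)).deriv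
  have hp0 : p + (0 : ℝ) • v ∈ U := by simpa
  have hfirst : deriv (fun t : ℝ => F (p + t • v)) =ᶠ[𝓝 0] fun t => dirDeriv v F (p + t • v) :=
    ((hline 0).continuousAt.eventually_mem (hU.mem_nhds hp0)).mono fun t ht => hderiv hF ht
  rw [hfirst.deriv_eq, hderiv (contDiffOn_dirDeriv hF hU v) hp0, zero_smul, add_zero]

lemma laplacianAlong_nonneg_of_isLocalMin (hF : ContDiffOn ℝ ∞ F U) (hU : IsOpen U) (hp : p ∈ U)
    (hmin : ∀ i, IsLocalMin (fun t : ℝ => F (p + t • e i)) 0) : 0 ≤ laplacianAlong e F p :=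
  Finset.sum_nonneg fun i _ => by
    rw [← deriv_deriv_line_eq_dirDeriv_dirDeriv hF hU hp]
    refine deriv_deriv_nonneg_of_isLocalMin (hmin i) ?_
    have hF' : ContinuousAt F (p + (0 : ℝ) • e i) := by
      simpa using (differentiableAt_of_contDiffOn hF hU hp).continuousAt
    exact ContinuousAt.comp (f := fun t : ℝ => p + t • e i) hF' (by fun_prop)

end LaplacianAlong

section EuclideanLaplacian

variable {E : Type*} [NormedAddCommGroup E] [InnerProductSpace ℝ E]
  {V : Type*} [NormedAddCommGroup V] [NormedSpace ℝ V] {ι : Type*} [Fintype ι]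
  (b : OrthonormalBasis ι ℝ E)

lemma laplacian_eq_laplacianAlong [FiniteDimensional ℝ E] {F : E → ℝ} {x : E}
    (hF : ContDiffAt ℝ 2 F x) : Laplacian.laplacian F x = laplacianAlong b F x := by
  rw [InnerProductSpace.laplacian_eq_iteratedFDeriv_orthonormalBasis F b]
  refine Finset.sum_congr rfl fun i _ => ?_
  rw [iteratedFDeriv_two_apply, dirDeriv_dirDeriv_eq_fderiv_fderiv hF]
  simp

lemma laplacianAlong_slice {F : ℝ × E → ℝ} {U : Set (ℝ × E)} (hF : ContDiffOn ℝ ∞ F U)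
    (hU : IsOpen U) {u : ℝ} {x : E} (hx : (u, x) ∈ U) :
    laplacianAlong b (fun y => F (u, y)) x = laplacianAlong (fun i => ((0 : ℝ), b i)) F (u, x) := by
  have hU' : IsOpen {y : E | (u, y) ∈ U} := hU.preimage (by fun_prop)
  have hslice {H : ℝ × E → ℝ} (hH : ContDiffOn ℝ ∞ H U) (v : E) :
      Set.EqOn (dirDeriv v fun y => H (u, y)) (fun y => dirDeriv ((0 : ℝ), v) H (u, y))
        {y : E | (u, y) ∈ U} := fun y hy =>
    dirDeriv_comp (differentiableAt_of_contDiffOn hH hU hy) (hasFDerivAt_prodMk_right u y) v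
  refine Finset.sum_congr rfl fun i _ => ?_
  rw [dirDeriv_congr hU' (hslice hF (b i)) _ hx, hslice (contDiffOn_dirDeriv hF hU _) _ hx]

lemma deriv_slice {F : ℝ × E → ℝ} {u : ℝ} {x : E} (hF : DifferentiableAt ℝ F (u, x)) :
    deriv (fun v => F (v, x)) u = dirDeriv ((1 : ℝ), (0 : E)) F (u, x) := by
  rw [← fderiv_apply_one_eq_deriv, ← dirDeriv]
  simpa using dirDeriv_comp (g := fun v : ℝ => (v, x)) hF (hasFDerivAt_prodMk_left u x) (1 : ℝ)

lemma dirDeriv_inner_const (π : V →L[ℝ] E) (w : E) (v p : V) :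
    dirDeriv v (fun q => inner ℝ (π q) w) p = inner ℝ (π v) w := by
  have h := ((π.hasFDerivAt (x := p)).inner ℝ (hasFDerivAt_const w p)).fderiv
  simp [dirDeriv, h]

lemma contDiffOn_norm_sq_add_rpow (π : V →L[ℝ] E) (c q : ℝ) :
    ContDiffOn ℝ ∞ (fun p => (‖π p‖ ^ 2 + c) ^ q) {p | 0 < ‖π p‖ ^ 2 + c} :=
  ContDiffOn.rpow_const_of_ne ((π.contDiff.norm_sq ℝ).add contDiff_const).contDiffOn
    fun _ hp => ne_of_gt hp

lemma dirDeriv_norm_sq_add_rpow (π : V →L[ℝ] E) (c q : ℝ) {p : V} (hp : 0 < ‖π p‖ ^ 2 + c)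
    (v : V) :
    dirDeriv v (fun p => (‖π p‖ ^ 2 + c) ^ q) p
      = 2 * q * (inner ℝ (π p) (π v) * (‖π p‖ ^ 2 + c) ^ (q - 1)) := by
  have h : HasFDerivAt (fun p => ‖π p‖ ^ 2 + c) (2 • (innerSL ℝ (π p)).comp π) p :=
    π.hasFDerivAt.norm_sq.add_const c
  rw [dirDeriv, (h.rpow_const (p := q) (Or.inl hp.ne')).fderiv]
  simp only [smul_apply, ContinuousLinearMap.comp_apply, innerSL_apply_apply,
    smul_eq_mul, nsmul_eq_mul, Nat.cast_ofNat]
  ring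

lemma laplacianAlong_norm_sq_add_rpow (π : V →L[ℝ] E) (e : ι → V) (he : ∀ i, π (e i) = b i)
    (c q : ℝ) {p : V} (hp : 0 < ‖π p‖ ^ 2 + c) :
    laplacianAlong e (fun p => (‖π p‖ ^ 2 + c) ^ q) p
      = 2 * q * (‖π p‖ ^ 2 + c) ^ (q - 2)
        * ((2 * q - 2 + Module.finrank ℝ E) * ‖π p‖ ^ 2 + Module.finrank ℝ E * c) := by
  have hU : IsOpen {p : V | 0 < ‖π p‖ ^ 2 + c} := isOpen_lt continuous_const (by fun_prop)
  have hterm (i : ι) : dirDeriv (e i) (dirDeriv (e i) fun p => (‖π p‖ ^ 2 + c) ^ q) p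
      = 2 * q * (2 * (q - 1) * (‖π p‖ ^ 2 + c) ^ (q - 2) * inner ℝ (π p) (b i) ^ 2
        + (‖π p‖ ^ 2 + c) ^ (q - 1)) := by
    rw [dirDeriv_congr hU (fun r hr => dirDeriv_norm_sq_add_rpow π c q hr (e i)) (e i) hp,
      dirDeriv_const_mul]
    beta_reduce
    rw [he, dirDeriv_mul (F := fun r => inner ℝ (π r) (b i))
        (π.differentiableAt.inner ℝ (differentiableAt_const _))
        (differentiableAt_of_contDiffOn (contDiffOn_norm_sq_add_rpow π c (q - 1)) hU hp),
      dirDeriv_norm_sq_add_rpow π c _ hp, dirDeriv_inner_const, he,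
      show q - 1 - 1 = q - 2 by ring, real_inner_self_eq_norm_sq, b.norm_eq_one]
    ring
  have hsum : ∑ i, inner ℝ (π p) (b i) ^ 2 = ‖π p‖ ^ 2 := by
    simpa [real_inner_comm, sq_abs] using b.sum_sq_norm_inner_left (π p)
  have hpow : (‖π p‖ ^ 2 + c) ^ (q - 1) = (‖π p‖ ^ 2 + c) ^ (q - 2) * (‖π p‖ ^ 2 + c) := by
    rw [← Real.rpow_add_one hp.ne', show q - 2 + 1 = q - 1 by ring]
  simp only [laplacianAlong, hterm]
  rw [← Finset.mul_sum, Finset.sum_add_distrib, ← Finset.mul_sum, hsum, hpow, Finset.sum_const,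
    Finset.card_univ, ← Module.finrank_eq_card_basis b.toBasis, nsmul_eq_mul]
  ring

end EuclideanLaplacian

section Homogeneous

/-- The product of a parameter line (retarded time) with a space punctured at the origin. -/
def puncturedSpace (E : Type*) [NormedAddCommGroup E] : Set (ℝ × E) := {p | p.2 ≠ 0}

lemma isOpen_puncturedSpace {E : Type*} [NormedAddCommGroup E] : IsOpen (puncturedSpace E) :=
  isOpen_ne.preimage continuous_snd

lemma norm_rpow_eq_norm_sq_add_zero_rpow {E : Type*} [NormedAddCommGroup E] (y : E) (γ : ℝ) :
    ‖y‖ ^ γ = (‖y‖ ^ 2 + 0) ^ (γ / 2) := by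
  rw [add_zero, ← Real.rpow_natCast_mul (norm_nonneg y)]
  congr 1; push_cast; ring

variable {E : Type*} [NormedAddCommGroup E] [InnerProductSpace ℝ E]

lemma inv_norm_smul_mem_sphere {y : E} (hy : y ≠ 0) : ‖y‖⁻¹ • y ∈ Metric.sphere (0 : E) 1 :=
  mem_sphere_zero_iff_norm.mpr (norm_smul_inv_norm (𝕜 := ℝ) hy)

/-- Functions of a parameter and a nonzero vector that are smooth in both variables and positively
homogeneous of degree `α` in the vector: these represent smooth functions on `ℝ × S`, `S` the unit
sphere, with the degree chosen to suit the equation at hand. -/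
structure IsHomog (α : ℝ) (F : ℝ × E → ℝ) : Prop where
  smooth : ContDiffOn ℝ ∞ F (puncturedSpace E)
  homog : ∀ (u : ℝ) (y : E) (t : ℝ), y ≠ 0 → 0 < t → F (u, t • y) = t ^ α * F (u, y)

namespace IsHomog

variable {α β : ℝ} {F G : ℝ × E → ℝ}

lemma differentiableAt (hF : IsHomog α F) {p : ℝ × E} (hp : p ∈ puncturedSpace E) :
    DifferentiableAt ℝ F p :=
  differentiableAt_of_contDiffOn hF.smooth isOpen_puncturedSpace hp

lemma eq_norm_rpow_mul (hF : IsHomog α F) (u : ℝ) {y : E} (hy : y ≠ 0) :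
    F (u, y) = ‖y‖ ^ α * F (u, ‖y‖⁻¹ • y) := by
  have hn : 0 < ‖y‖ := norm_pos_iff.mpr hy
  rw [← hF.homog u _ _ (smul_ne_zero (inv_ne_zero hn.ne') hy) hn, smul_smul,
    mul_inv_cancel₀ hn.ne', one_smul]

lemma eqOn_of_eqOn_sphere (hF : IsHomog α F) (hG : IsHomog α G)
    (h : ∀ u, ∀ x ∈ Metric.sphere (0 : E) 1, F (u, x) = G (u, x)) :
    Set.EqOn F G (puncturedSpace E) := fun ⟨u, _⟩ hy => by
  rw [hF.eq_norm_rpow_mul u hy, hG.eq_norm_rpow_mul u hy, h u _ (inv_norm_smul_mem_sphere hy)]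

lemma continuousOn_slice (hF : IsHomog α F) (u : ℝ) :
    ContinuousOn (fun y => F (u, y)) {y : E | y ≠ 0} :=
  hF.smooth.continuousOn.comp (by fun_prop) fun _ hy => hy

lemma const_mul (c : ℝ) (hF : IsHomog α F) : IsHomog α fun p => c * F p where
  smooth := contDiffOn_const.mul hF.smooth
  homog u y t hy ht := by rw [hF.homog u y t hy ht]; ring

lemma sub (hF : IsHomog α F) (hG : IsHomog α G) : IsHomog α fun p => F p - G p where
  smooth := hF.smooth.sub hG.smooth
  homog u y t hy ht := by rw [hF.homog u y t hy ht, hG.homog u y t hy ht]; ring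

lemma sum {κ : Type*} (s : Finset κ) {H : κ → ℝ × E → ℝ} (hH : ∀ k ∈ s, IsHomog α (H k)) :
    IsHomog α fun p => ∑ k ∈ s, H k p where
  smooth := ContDiffOn.sum fun k hk => (hH k hk).smooth
  homog u y t hy ht := by
    rw [Finset.mul_sum]
    exact Finset.sum_congr rfl fun k hk => (hH k hk).homog u y t hy ht

lemma mul (hF : IsHomog α F) (hG : IsHomog β G) : IsHomog (α + β) fun p => F p * G p where
  smooth := hF.smooth.mul hG.smooth
  homog u y t hy ht := by
    rw [hF.homog u y t hy ht, hG.homog u y t hy ht, Real.rpow_add ht]; ring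

lemma inner_const (v : E) : IsHomog 1 fun p : ℝ × E => inner ℝ p.2 v where
  smooth := (contDiff_snd.inner ℝ contDiff_const).contDiffOn
  homog u y t _ _ := by simp [inner_smul_left]

lemma norm_rpow (β : ℝ) : IsHomog β fun p : ℝ × E => ‖p.2‖ ^ β where
  smooth := (contDiff_snd.contDiffOn.norm ℝ fun _ hp => hp).rpow_const_of_ne
    fun _ hp => norm_ne_zero_iff.mpr hp
  homog u y t _ ht := by
    rw [norm_smul, Real.norm_of_nonneg ht.le, Real.mul_rpow ht.le (norm_nonneg y)]

lemma dirDeriv_snd (hF : IsHomog α F) (v : E) : IsHomog (α - 1) (dirDeriv ((0 : ℝ), v) F) where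
  smooth := contDiffOn_dirDeriv hF.smooth isOpen_puncturedSpace _
  homog u y t hy ht := by
    let dilation : ℝ × E →L[ℝ] ℝ × E :=
      (ContinuousLinearMap.fst ℝ ℝ E).prod (t • ContinuousLinearMap.snd ℝ ℝ E)
    have hchain : dirDeriv ((0 : ℝ), v) (fun p => F (dilation p)) (u, y)
        = t * dirDeriv ((0 : ℝ), v) F (u, t • y) := by
      have hd : dilation ((0 : ℝ), v) = t • ((0 : ℝ), v) := by simp [dilation]
      have hF' : DifferentiableAt ℝ F (dilation (u, y)) :=
        hF.differentiableAt (smul_ne_zero ht.ne' hy)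
      rw [dirDeriv_comp hF' dilation.hasFDerivAt, hd, dirDeriv, map_smul, smul_eq_mul]
      rfl
    have hscale : dirDeriv ((0 : ℝ), v) (fun p => F (dilation p)) (u, y)
        = t ^ α * dirDeriv ((0 : ℝ), v) F (u, y) := by
      have h := dirDeriv_congr isOpen_puncturedSpace
        (fun p hp => hF.homog p.1 p.2 t hp ht) ((0 : ℝ), v) (x := (u, y)) hy
      rwa [dirDeriv_const_mul] at h
    rw [Real.rpow_sub_one ht.ne', div_mul_eq_mul_div, ← hscale, hchain,
      mul_div_cancel_left₀ _ ht.ne']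

lemma dirDeriv_radial (hF : IsHomog α F) (u : ℝ) {y : E} (hy : y ≠ 0) :
    dirDeriv ((0 : ℝ), y) F (u, y) = α * F (u, y) := by
  have hray : HasDerivAt (fun t : ℝ => (u, t • y)) ((0 : ℝ), y) 1 := by
    simpa using (hasDerivAt_const (1 : ℝ) u).prodMk ((hasDerivAt_id (1 : ℝ)).smul_const y)
  have hd : DifferentiableAt ℝ F (u, (1 : ℝ) • y) := hF.differentiableAt (by simpa)
  have hpow : HasDerivAt (fun t : ℝ => t ^ α * F (u, y)) (α * F (u, y)) 1 := by
    simpa using (Real.hasDerivAt_rpow_const (x := 1) (p := α) (by simp)).mul_const (F (u, y))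
  have heq : (F ∘ fun t : ℝ => (u, t • y)) =ᶠ[𝓝 1] fun t => t ^ α * F (u, y) := by
    filter_upwards [lt_mem_nhds (zero_lt_one' ℝ)] with t ht using hF.homog u y t hy ht
  simpa [dirDeriv] using
    (hd.hasFDerivAt.comp_hasDerivAt (1 : ℝ) hray).unique (hpow.congr_of_eventuallyEq heq)

end IsHomog

variable {ι : Type*} [Fintype ι] (b : OrthonormalBasis ι ℝ E)

lemma sum_inner_mul_dirDeriv_snd (F : ℝ × E → ℝ) (p : ℝ × E) (y : E) :
    ∑ i, inner ℝ y (b i) * dirDeriv ((0 : ℝ), b i) F p = dirDeriv ((0 : ℝ), y) F p := by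
  have hy : ((0 : ℝ), y) = ∑ i, inner ℝ y (b i) • ((0 : ℝ), b i) := by
    refine Prod.ext (by simp [Prod.fst_sum]) ?_
    simpa [Prod.snd_sum, real_inner_comm] using (b.sum_repr' y).symm
  simp only [dirDeriv, hy, map_sum, map_smul, smul_eq_mul]

lemma dirDeriv_norm_rpow_snd (β : ℝ) {p : ℝ × E} (hp : p ∈ puncturedSpace E) (v : E) :
    dirDeriv ((0 : ℝ), v) (fun p => ‖p.2‖ ^ β) p = β * ‖p.2‖ ^ (β - 2) * inner ℝ p.2 v := by
  have h0 : 0 < ‖p.2‖ ^ 2 + 0 := by simpa using pow_pos (norm_pos_iff.mpr hp) 2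
  simp only [norm_rpow_eq_norm_sq_add_zero_rpow]
  refine (dirDeriv_norm_sq_add_rpow (ContinuousLinearMap.snd ℝ ℝ E) 0 (β / 2) h0 _).trans ?_
  simp only [ContinuousLinearMap.coe_snd']
  rw [show (β - 2) / 2 = β / 2 - 1 by ring]
  ring

variable [FiniteDimensional ℝ E]

/-- The Laplacian in the second variable. -/
noncomputable def fiberLaplacian (F : ℝ × E → ℝ) : ℝ × E → ℝ :=
  laplacianAlong (fun i => ((0 : ℝ), stdOrthonormalBasis ℝ E i)) F

variable {α β : ℝ} {F G : ℝ × E → ℝ} {p : ℝ × E}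

lemma fiberLaplacian_norm_rpow (β : ℝ) (hp : p ∈ puncturedSpace E) :
    fiberLaplacian (fun p : ℝ × E => ‖p.2‖ ^ β) p
      = β * (β + Module.finrank ℝ E - 2) * ‖p.2‖ ^ (β - 2) := by
  have h0 : 0 < ‖p.2‖ ^ 2 + 0 := by simpa using pow_pos (norm_pos_iff.mpr hp) 2
  simp only [norm_rpow_eq_norm_sq_add_zero_rpow]
  refine (laplacianAlong_norm_sq_add_rpow (stdOrthonormalBasis ℝ E)
    (ContinuousLinearMap.snd ℝ ℝ E) _ (fun _ => rfl) 0 (β / 2) h0).trans ?_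
  simp only [ContinuousLinearMap.coe_snd']
  rw [show (β - 2) / 2 = β / 2 - 2 + 1 by ring, Real.rpow_add_one h0.ne']
  ring

lemma IsHomog.isHomog_fiberLaplacian (hF : IsHomog α F) : IsHomog (α - 2) (fiberLaplacian F) :=
  IsHomog.sum Finset.univ fun i _ => by
    simpa only [sub_sub, one_add_one_eq_two] using
      (hF.dirDeriv_snd (stdOrthonormalBasis ℝ E i)).dirDeriv_snd (stdOrthonormalBasis ℝ E i)

lemma IsHomog.fiberLaplacian_norm_rpow_mul (hF : IsHomog β F) (α : ℝ) (hp : p ∈ puncturedSpace E) :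
    fiberLaplacian (fun p => ‖p.2‖ ^ α * F p) p
      = ‖p.2‖ ^ α * fiberLaplacian F p
        + α * (α + 2 * β + Module.finrank ℝ E - 2) * ‖p.2‖ ^ (α - 2) * F p := by
  have hcross : ∑ i, dirDeriv ((0 : ℝ), stdOrthonormalBasis ℝ E i) (fun p => ‖p.2‖ ^ α) p
      * dirDeriv ((0 : ℝ), stdOrthonormalBasis ℝ E i) F p
      = α * ‖p.2‖ ^ (α - 2) * (β * F p) := by
    rw [← hF.dirDeriv_radial p.1 hp, ← sum_inner_mul_dirDeriv_snd (stdOrthonormalBasis ℝ E),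
      Finset.mul_sum]
    refine Finset.sum_congr rfl fun i _ => ?_
    rw [dirDeriv_norm_rpow_snd α hp, mul_assoc]
  have hΔ := fiberLaplacian_norm_rpow α hp
  rw [fiberLaplacian] at hΔ ⊢
  rw [laplacianAlong_mul _ (IsHomog.norm_rpow α).smooth hF.smooth isOpen_puncturedSpace hp, hΔ,
    hcross, fiberLaplacian]
  ring

lemma IsHomog.exists_le_mul_norm_rpow [Nontrivial E] (hF : IsHomog α F) (u : ℝ) :
    ∃ x : E, ‖x‖ = 1 ∧ ∀ z ≠ 0, F (u, z) ≤ F (u, x) * ‖z‖ ^ α := by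
  obtain ⟨x, hx, hmax⟩ := (isCompact_sphere (0 : E) 1).exists_isMaxOn
    (NormedSpace.sphere_nonempty.mpr zero_le_one)
    ((hF.continuousOn_slice u).mono fun _ hz => ne_zero_of_mem_unit_sphere ⟨_, hz⟩)
  refine ⟨x, mem_sphere_zero_iff_norm.mp hx, fun z hz => ?_⟩
  rw [hF.eq_norm_rpow_mul u hz, mul_comm (F _)]
  exact mul_le_mul_of_nonneg_left (hmax (inv_norm_smul_mem_sphere hz)) (by positivity)

lemma fiberLaplacian_le_of_le (hF : ContDiffOn ℝ ∞ F (puncturedSpace E))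
    (hG : ContDiffOn ℝ ∞ G (puncturedSpace E)) (hp : p ∈ puncturedSpace E)
    (hle : ∀ z ≠ 0, F (p.1, z) ≤ G (p.1, z)) (heq : F p = G p) :
    fiberLaplacian F p ≤ fiberLaplacian G p := by
  rw [← sub_nonneg, fiberLaplacian, fiberLaplacian,
    ← laplacianAlong_sub _ hG hF isOpen_puncturedSpace hp]
  refine laplacianAlong_nonneg_of_isLocalMin _ (hG.sub hF) isOpen_puncturedSpace hp fun i => ?_
  have hc : Continuous fun t : ℝ => p.2 + t • stdOrthonormalBasis ℝ E i := by fun_prop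
  filter_upwards [hc.continuousAt.eventually_ne (y := 0) (by rwa [zero_smul, add_zero])] with t ht
  have hline : p + t • ((0 : ℝ), stdOrthonormalBasis ℝ E i)
      = (p.1, p.2 + t • stdOrthonormalBasis ℝ E i) := by ext <;> simp
  rw [zero_smul, add_zero, heq, sub_self, hline]
  exact sub_nonneg.mpr (hle _ ht)

variable (E) in
/-- The only homogeneous harmonic function of degree `α` on the punctured space is `0`. -/
def HarmonicUnique (α : ℝ) : Prop :=
  ∀ F : ℝ × E → ℝ, IsHomog α F → Set.EqOn (fiberLaplacian F) 0 (puncturedSpace E) →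
    Set.EqOn F 0 (puncturedSpace E)

variable (E) in
/-- Poisson's equation on the punctured space with a homogeneous right-hand side has a solution
homogeneous of degree `α`. -/
def PoissonSolvable (α : ℝ) : Prop :=
  ∀ G : ℝ × E → ℝ, IsHomog (α - 2) G →
    ∃ F, IsHomog α F ∧ Set.EqOn (fiberLaplacian F) G (puncturedSpace E)

-- Maximum principle: at its maximum on the sphere, `F` touches from below a multiple of
-- `‖y‖ ^ α`, which is strictly superharmonic.
lemma IsHomog.nonpos_of_harmonic (hα : α < 0) (hα' : 2 - (Module.finrank ℝ E : ℝ) < α)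
    (hF : IsHomog α F) (h0 : Set.EqOn (fiberLaplacian F) 0 (puncturedSpace E))
    (hp : p ∈ puncturedSpace E) : F p ≤ 0 := by
  have : Nontrivial E := ⟨p.2, 0, hp⟩
  obtain ⟨x, hx, hle⟩ := hF.exists_le_mul_norm_rpow p.1
  have hx0 : (p.1, x) ∈ puncturedSpace E := norm_ne_zero_iff.mp (hx.trans_ne one_ne_zero)
  have hmax : F (p.1, x) ≤ 0 := by
    have h := fiberLaplacian_le_of_le hF.smooth ((IsHomog.norm_rpow α).const_mul _).smooth hx0
      hle (by simp [hx])
    have hΔ := fiberLaplacian_norm_rpow α hx0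
    rw [fiberLaplacian] at hΔ
    rw [h0 hx0, fiberLaplacian, laplacianAlong_const_mul, hΔ, hx, Real.one_rpow, mul_one] at h
    exact nonpos_of_mul_nonneg_left h (mul_neg_of_neg_of_pos hα (by linarith))
  exact (hle p.2 hp).trans (mul_nonpos_of_nonpos_of_nonneg hmax (by positivity))

lemma harmonicUnique_of_neg (hα : α < 0) (hα' : 2 - (Module.finrank ℝ E : ℝ) < α) :
    HarmonicUnique E α := fun F hF h0 p hp => by
  have hneg : Set.EqOn (fiberLaplacian fun p => -1 * F p) 0 (puncturedSpace E) := fun q hq => by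
    rw [fiberLaplacian, laplacianAlong_const_mul, ← fiberLaplacian, h0 hq]
    simp
  have := (hF.const_mul (-1)).nonpos_of_harmonic hα hα' hneg hp
  exact le_antisymm (hF.nonpos_of_harmonic hα hα' h0 hp) (by simpa using this)

lemma fiberLaplacian_dirDeriv_snd (hF : ContDiffOn ℝ ∞ F (puncturedSpace E))
    (h : Set.EqOn (fiberLaplacian F) G (puncturedSpace E)) (v : E) :
    Set.EqOn (fiberLaplacian (dirDeriv ((0 : ℝ), v) F)) (dirDeriv ((0 : ℝ), v) G)
      (puncturedSpace E) := fun _ hp =>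
  (laplacianAlong_dirDeriv _ hF isOpen_puncturedSpace _ hp).trans
    (dirDeriv_congr isOpen_puncturedSpace h _ hp)

lemma HarmonicUnique.succ (h : HarmonicUnique E (α - 1)) (hα : α ≠ 0) : HarmonicUnique E α :=
  fun F hF h0 p hp => by
    have hzero : dirDeriv ((0 : ℝ), p.2) F p = 0 :=
      h _ (hF.dirDeriv_snd p.2) (fun q hq =>
        (fiberLaplacian_dirDeriv_snd hF.smooth h0 p.2 hq).trans
          (congrFun (dirDeriv_const _ 0) q)) hp
    rw [hF.dirDeriv_radial p.1 hp] at hzero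
    exact (mul_eq_zero.mp hzero).resolve_left hα

lemma fiberLaplacian_inner_mul (hF : ContDiffOn ℝ ∞ F (puncturedSpace E)) (v : E)
    (hp : p ∈ puncturedSpace E) :
    fiberLaplacian (fun q => inner ℝ q.2 v * F q) p
      = inner ℝ p.2 v * fiberLaplacian F p + 2 * dirDeriv ((0 : ℝ), v) F p := by
  have hinner (w : E) : dirDeriv ((0 : ℝ), w) (fun q : ℝ × E => inner ℝ q.2 v)
      = fun _ => inner ℝ w v :=
    funext fun q => dirDeriv_inner_const (ContinuousLinearMap.snd ℝ ℝ E) v ((0 : ℝ), w) q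
  have hharmonic : fiberLaplacian (fun q : ℝ × E => inner ℝ q.2 v) p = 0 := by
    simp only [fiberLaplacian, laplacianAlong, hinner, dirDeriv_const, Finset.sum_const_zero]
  rw [fiberLaplacian] at hharmonic ⊢
  rw [laplacianAlong_mul _ (IsHomog.inner_const v).smooth hF isOpen_puncturedSpace hp, hharmonic,
    ← sum_inner_mul_dirDeriv_snd (stdOrthonormalBasis ℝ E), fiberLaplacian]
  simp only [hinner, real_inner_comm v (stdOrthonormalBasis ℝ E _), mul_zero, add_zero]

lemma HarmonicUnique.sum_dirDeriv_eq (h : HarmonicUnique E (α - 2)) (hG : IsHomog (α - 2) G)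
    {H : Fin (Module.finrank ℝ E) → ℝ × E → ℝ} (hH : ∀ i, IsHomog (α - 1) (H i))
    (hHG : ∀ i, Set.EqOn (fiberLaplacian (H i))
      (dirDeriv ((0 : ℝ), stdOrthonormalBasis ℝ E i) G) (puncturedSpace E)) :
    Set.EqOn (fun p => ∑ i, dirDeriv ((0 : ℝ), stdOrthonormalBasis ℝ E i) (H i) p) G
      (puncturedSpace E) := fun p hp => by
  have hdH (i) : IsHomog (α - 2) (dirDeriv ((0 : ℝ), stdOrthonormalBasis ℝ E i) (H i)) := by
    simpa only [sub_sub, one_add_one_eq_two] using (hH i).dirDeriv_snd (stdOrthonormalBasis ℝ E i)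
  have hdiv := IsHomog.sum Finset.univ fun i _ => hdH i
  refine sub_eq_zero.mp (h _ (hdiv.sub hG) (fun q hq => ?_) hp)
  rw [fiberLaplacian, laplacianAlong_sub _ hdiv.smooth hG.smooth isOpen_puncturedSpace hq,
    laplacianAlong_sum _ _ (fun i _ => (hdH i).smooth) isOpen_puncturedSpace hq]
  exact sub_eq_zero.mpr (Finset.sum_congr rfl fun i _ =>
    fiberLaplacian_dirDeriv_snd (hH i).smooth (hHG i) _ hq)

-- If `Δ Hᵢ = ∂ᵢ G`, then `∑ ∂ᵢ Hᵢ = G` by uniqueness, and hence `Δ (∑ yᵢ Hᵢ) = α G` by Euler's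
-- identity.
lemma PoissonSolvable.succ (h : PoissonSolvable E (α - 1)) (h' : HarmonicUnique E (α - 2))
    (hα : α ≠ 0) : PoissonSolvable E α := fun G hG => by
  set b := stdOrthonormalBasis ℝ E
  have hdG (i) : IsHomog (α - 1 - 2) (dirDeriv ((0 : ℝ), b i) G) := by
    simpa only [sub_right_comm] using hG.dirDeriv_snd (b i)
  choose H hH hHG using fun i => h _ (hdG i)
  have hprod (i) : IsHomog α fun p => inner ℝ p.2 (b i) * H i p := by
    simpa only [add_sub_cancel] using (IsHomog.inner_const (b i)).mul (hH i)
  refine ⟨fun p => α⁻¹ * ∑ i, inner ℝ p.2 (b i) * H i p,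
    (IsHomog.sum _ fun i _ => hprod i).const_mul _, fun p hp => ?_⟩
  have hterm (i) : fiberLaplacian (fun p => inner ℝ p.2 (b i) * H i p) p
      = inner ℝ p.2 (b i) * dirDeriv ((0 : ℝ), b i) G p + 2 * dirDeriv ((0 : ℝ), b i) (H i) p := by
    rw [fiberLaplacian_inner_mul (hH i).smooth _ hp, hHG i hp]
  calc fiberLaplacian (fun p => α⁻¹ * ∑ i, inner ℝ p.2 (b i) * H i p) p
      = α⁻¹ * ∑ i, fiberLaplacian (fun p => inner ℝ p.2 (b i) * H i p) p := by
        rw [fiberLaplacian, laplacianAlong_const_mul]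
        exact congrArg _ (laplacianAlong_sum _ _ (fun i _ => (hprod i).smooth)
          isOpen_puncturedSpace hp)
    _ = α⁻¹ * (dirDeriv ((0 : ℝ), p.2) G p
          + 2 * ∑ i, dirDeriv ((0 : ℝ), b i) (H i) p) := by
        simp only [hterm, Finset.sum_add_distrib, ← Finset.mul_sum,
          sum_inner_mul_dirDeriv_snd b G p]
    _ = α⁻¹ * ((α - 2) * G p + 2 * G p) := by
        rw [hG.dirDeriv_radial p.1 hp]
        exact congrArg (fun s => α⁻¹ * ((α - 2) * G p + 2 * s)) (h'.sum_dirDeriv_eq hG hH hHG hp)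
    _ = G p := by field_simp; ring

end Homogeneous

section ParametricIntegral

lemma isOpen_forall_mem_of_isCompact {X Y : Type*} [TopologicalSpace X] [TopologicalSpace Y]
    {K : Set Y} {W : Set (X × Y)} (hK : IsCompact K) (hW : IsOpen W) :
    IsOpen {x | ∀ y ∈ K, (x, y) ∈ W} :=
  isOpen_iff_mem_nhds.mpr fun _ hx =>
    hK.eventually_forall_of_forall_eventually fun y hy => hW.mem_nhds (hx y hy)

variable {P Q F : Type*} [NormedAddCommGroup P] [NormedAddCommGroup Q] [MeasurableSpace Q]
  [BorelSpace Q] [NormedAddCommGroup F] {μ : Measure Q} [IsLocallyFiniteMeasure μ] {K : Set Q}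
  {W : Set (P × Q)} {Ψ : P × Q → F}

lemma integrableOn_slice_of_isCompact (hK : IsCompact K) (hΨ : ContinuousOn Ψ W) {p : P}
    (hp : ∀ q ∈ K, (p, q) ∈ W) : IntegrableOn (fun q => Ψ (p, q)) K μ :=
  (hΨ.comp (by fun_prop) hp).integrableOn_compact hK

variable [NormedSpace ℝ P] [NormedSpace ℝ Q] [NormedSpace ℝ F]

lemma hasFDerivAt_setIntegral_of_isCompact (hK : IsCompact K) (hW : IsOpen W)
    (hΨ : ContDiffOn ℝ ∞ Ψ W) {p : P} (hp : ∀ q ∈ K, (p, q) ∈ W) :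
    HasFDerivAt (fun p => ∫ q in K, Ψ (p, q) ∂μ)
      (∫ q in K, (fderiv ℝ Ψ (p, q)).comp (ContinuousLinearMap.inl ℝ P Q) ∂μ) p := by
  set D : P × Q → P →L[ℝ] F := fun z => (fderiv ℝ Ψ z).comp (ContinuousLinearMap.inl ℝ P Q)
  have hD : ContinuousOn D W :=
    (hΨ.continuousOn_fderiv_of_isOpen hW (by simp)).clm_comp continuousOn_const
  have hDp : ContinuousOn (fun q => D (p, q)) K := hD.comp (by fun_prop) hp
  obtain ⟨C, hC⟩ := hK.exists_bound_of_continuousOn hDp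
  have hWC : IsOpen (W ∩ D ⁻¹' {A | ‖A‖ < C + 1}) :=
    hD.isOpen_inter_preimage hW (isOpen_lt continuous_norm continuous_const)
  have hs : {p' | ∀ q ∈ K, (p', q) ∈ W ∩ D ⁻¹' {A | ‖A‖ < C + 1}} ∈ 𝓝 p :=
    (isOpen_forall_mem_of_isCompact hK hWC).mem_nhds fun q hq =>
      ⟨hp q hq, (hC q hq).trans_lt (lt_add_one C)⟩
  have hKm : MeasurableSet K := hK.measurableSet
  refine hasFDerivAt_integral_of_dominated_of_fderiv_le (bound := fun _ => C + 1)
    (F' := fun p' q => D (p', q)) hs ?_ (integrableOn_slice_of_isCompact hK hΨ.continuousOn hp)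
    (integrableOn_slice_of_isCompact hK hD hp).aestronglyMeasurable ?_
    (integrableOn_const hK.measure_ne_top) ?_
  · filter_upwards [(isOpen_forall_mem_of_isCompact hK hW).mem_nhds hp] with p' hp'
    exact (integrableOn_slice_of_isCompact hK hΨ.continuousOn hp').aestronglyMeasurable
  · exact ae_restrict_of_forall_mem hKm fun q hq p' hp' => (hp' q hq).2.le
  · refine ae_restrict_of_forall_mem hKm fun q hq p' hp' => ?_
    have hd := (hΨ.contDiffAt (hW.mem_nhds (hp' q hq).1)).differentiableAt (by simp)
    exact hd.hasFDerivAt.comp p' (hasFDerivAt_prodMk_left p' q)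

theorem contDiffOn_setIntegral_of_isCompact [FiniteDimensional ℝ P] (hK : IsCompact K)
    (hW : IsOpen W) (hΨ : ContDiffOn ℝ ∞ Ψ W) :
    ContDiffOn ℝ ∞ (fun p => ∫ q in K, Ψ (p, q) ∂μ) {p | ∀ q ∈ K, (p, q) ∈ W} := by
  have hopen := isOpen_forall_mem_of_isCompact hK hW
  rw [contDiffOn_infty]
  intro n
  induction n generalizing Ψ with
  | zero =>
    rw [Nat.cast_zero, contDiffOn_zero]
    exact fun p hp =>
      (hasFDerivAt_setIntegral_of_isCompact hK hW hΨ hp).continuousAt.continuousWithinAt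
  | succ n ih =>
    rw [Nat.cast_succ, contDiffOn_succ_iff_fderiv_apply hopen.uniqueDiffOn]
    refine ⟨fun p hp => (hasFDerivAt_setIntegral_of_isCompact hK hW hΨ hp).differentiableAt
      |>.differentiableWithinAt, by simp, fun v => ?_⟩
    have hD : ContDiffOn ℝ ∞
        (fun z => (fderiv ℝ Ψ z).comp (ContinuousLinearMap.inl ℝ P Q)) W :=
      (hΨ.fderiv_of_isOpen hW (by simp)).clm_comp contDiffOn_const
    refine (ih (hD.clm_apply (contDiffOn_const (c := v)))).congr fun p hp => ?_
    rw [fderivWithin_of_isOpen hopen hp,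
      (hasFDerivAt_setIntegral_of_isCompact hK hW hΨ hp).fderiv,
      ContinuousLinearMap.integral_apply (integrableOn_slice_of_isCompact hK hD.continuousOn hp)]

end ParametricIntegral

section TestFunctions

lemma integrable_mul_of_tsupport_subset {X : Type*} [TopologicalSpace X] [T2Space X]
    [MeasurableSpace X] [OpensMeasurableSpace X] {μ : Measure X} [IsLocallyFiniteMeasure μ]
    {U : Set X} {f h : X → ℝ} (hf : ContinuousOn f U) (hh : Continuous h)
    (hc : HasCompactSupport h) (hs : tsupport h ⊆ U) : Integrable (fun x => f x * h x) μ := by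
  have hK : IntegrableOn (fun x => f x * h x) (tsupport h) μ :=
    ((hf.mono hs).mul hh.continuousOn).integrableOn_compact hc
  exact (integrableOn_iff_integrable_of_support_subset fun x hx =>
    subset_tsupport h (right_ne_zero_of_mul hx)).mp hK

variable {E : Type*} [NormedAddCommGroup E] [NormedSpace ℝ E] {U : Set E} {f h : E → ℝ}

lemma hasCompactSupport_laplacianAlong {ι : Type*} [Fintype ι] (e : ι → E)
    (hc : HasCompactSupport h) : HasCompactSupport (laplacianAlong e h) :=
  hc.of_isClosed_subset (isClosed_tsupport _) (tsupport_laplacianAlong_subset e h)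

variable [MeasurableSpace E] [BorelSpace E] {μ : Measure E}

lemma tendsto_integral_mul_comp_smul {w : E → ℝ} (hw : Integrable w μ) (hh : Continuous h)
    (hc : HasCompactSupport h) :
    Tendsto (fun ε : ℝ => ∫ z, w z * h (ε • z) ∂μ) (𝓝 0) (𝓝 ((∫ z, w z ∂μ) * h 0)) := by
  obtain ⟨C, hC⟩ := hc.exists_bound_of_continuous hh
  rw [← integral_mul_const]
  refine tendsto_integral_filter_of_dominated_convergence (fun z => ‖w z‖ * C)
    (.of_forall fun ε => ?_) (.of_forall fun ε => .of_forall fun z => ?_)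
    (hw.norm.mul_const C) (.of_forall fun z => ?_)
  · exact hw.aestronglyMeasurable.mul (Measurable.aestronglyMeasurable
      (hh.measurable.comp (measurable_const_smul ε)))
  · rw [norm_mul]
    exact mul_le_mul_of_nonneg_left (hC _) (norm_nonneg _)
  · refine ((hh.tendsto 0).comp ?_).const_mul _
    simpa using (tendsto_id (x := 𝓝 (0 : ℝ))).smul_const z

variable [FiniteDimensional ℝ E] [μ.IsAddHaarMeasure]

lemma integral_mul_dirDeriv (hU : IsOpen U) (hf : ContDiffOn ℝ ∞ f U) (hh : ContDiff ℝ ∞ h)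
    (hc : HasCompactSupport h) (hs : tsupport h ⊆ U) (v : E) :
    ∫ x, f x * dirDeriv v h x ∂μ = - ∫ x, dirDeriv v f x * h x ∂μ :=
  integral_mul_fderiv_eq_neg_fderiv_mul_of_integrable
    (integrable_mul_of_tsupport_subset (contDiffOn_dirDeriv hf hU v).continuousOn
      hh.continuous hc hs)
    (integrable_mul_of_tsupport_subset hf.continuousOn (contDiff_dirDeriv hh v).continuous
      (hc.fderiv_apply ℝ v) ((tsupport_dirDeriv_subset h v).trans hs))
    (integrable_mul_of_tsupport_subset hf.continuousOn hh.continuous hc hs)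
    (fun _ hx => differentiableAt_of_contDiffOn hf hU (hs hx))
    (fun x _ => hh.differentiable (by simp) x)

lemma integral_mul_laplacianAlong {ι : Type*} [Fintype ι] (e : ι → E) (hU : IsOpen U)
    (hf : ContDiffOn ℝ ∞ f U) (hh : ContDiff ℝ ∞ h) (hc : HasCompactSupport h)
    (hs : tsupport h ⊆ U) :
    ∫ x, f x * laplacianAlong e h x ∂μ = ∫ x, laplacianAlong e f x * h x ∂μ := by
  have hdh (v : E) : ContDiff ℝ ∞ (dirDeriv v h) := contDiff_dirDeriv hh v
  have hdc (v : E) : HasCompactSupport (dirDeriv v h) := hc.fderiv_apply ℝ v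
  have hds (v : E) : tsupport (dirDeriv v h) ⊆ U := (tsupport_dirDeriv_subset h v).trans hs
  have hdf (v : E) : ContDiffOn ℝ ∞ (dirDeriv v f) U := contDiffOn_dirDeriv hf hU v
  simp only [laplacianAlong, Finset.mul_sum, Finset.sum_mul]
  rw [integral_finsetSum _ fun i _ => integrable_mul_of_tsupport_subset hf.continuousOn
      (contDiff_dirDeriv (hdh (e i)) (e i)).continuous ((hdc _).fderiv_apply ℝ _)
      ((tsupport_dirDeriv_subset _ _).trans (hds _)),
    integral_finsetSum _ fun i _ => integrable_mul_of_tsupport_subset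
      (contDiffOn_dirDeriv (hdf (e i)) hU (e i)).continuousOn hh.continuous hc hs]
  refine Finset.sum_congr rfl fun i _ => ?_
  rw [integral_mul_dirDeriv hU hf (hdh _) (hdc _) (hds _),
    integral_mul_dirDeriv hU (hdf _) hh hc hs, neg_neg]

end TestFunctions

section Newton

variable {E : Type*} [NormedAddCommGroup E] [InnerProductSpace ℝ E] [FiniteDimensional ℝ E]
  [MeasurableSpace E] [BorelSpace E]

local notation "dimE" => (Module.finrank ℝ E : ℝ)

section FundamentalSolution

variable {h : E → ℝ}

variable (E) in
/-- The constant `c` for which `-c⁻¹ ‖x‖ ^ (2 - dim E)` is the fundamental solution of the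
Laplacian: minus the integral of the Laplacian of `(1 + ‖x‖ ^ 2) ^ ((2 - dim E) / 2)`. -/
noncomputable def newtonConst : ℝ :=
  (dimE - 2) * dimE * ∫ z : E, (1 + ‖z‖ ^ 2) ^ (-(dimE + 2) / 2)

lemma newtonConst_pos (hE : 3 ≤ Module.finrank ℝ E) : 0 < newtonConst E := by
  have hE' : (3 : ℝ) ≤ dimE := by exact_mod_cast hE
  have hpos (z : E) : 0 < (1 + ‖z‖ ^ 2) ^ (-(dimE + 2) / 2) := by positivity
  have hint : Integrable fun z : E => (1 + ‖z‖ ^ 2) ^ (-(dimE + 2) / 2) :=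
    integrable_rpow_neg_one_add_norm_sq (by linarith)
  refine mul_pos (mul_pos (by linarith) (by linarith)) ?_
  rw [integral_pos_iff_support_of_nonneg (fun z => (hpos z).le) hint,
    show (Function.support fun z : E => (1 + ‖z‖ ^ 2) ^ (-(dimE + 2) / 2)) = Set.univ from
      Set.eq_univ_of_forall fun z => (hpos z).ne']
  exact Measure.measure_univ_pos.mpr (NeZero.ne _)

lemma integral_norm_sq_add_sq_rpow_mul_laplacianAlong
    (b : OrthonormalBasis (Fin (Module.finrank ℝ E)) ℝ E) (hh : ContDiff ℝ ∞ h)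
    (hc : HasCompactSupport h) {ε : ℝ} (hε : 0 < ε) :
    ∫ x : E, (‖x‖ ^ 2 + ε ^ 2) ^ ((2 - dimE) / 2) * laplacianAlong b h x
      = -((dimE - 2) * dimE) * ∫ z : E, (1 + ‖z‖ ^ 2) ^ (-(dimE + 2) / 2) * h (ε • z) := by
  obtain ⟨M, hM⟩ : ∃ M : ℝ, M = dimE := ⟨_, rfl⟩
  rw [← hM]
  have hpos (x : E) : 0 < ‖x‖ ^ 2 + ε ^ 2 := by positivity
  have hsmooth : ContDiffOn ℝ ∞ (fun x : E => (‖x‖ ^ 2 + ε ^ 2) ^ ((2 - M) / 2)) Set.univ :=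
    (contDiffOn_norm_sq_add_rpow (ContinuousLinearMap.id ℝ E) (ε ^ 2) ((2 - M) / 2)).mono
      fun x _ => hpos x
  have hlap (x : E) := laplacianAlong_norm_sq_add_rpow b (ContinuousLinearMap.id ℝ E) (e := b)
    (fun i => rfl) (ε ^ 2) ((2 - M) / 2) (p := x) (hpos x)
  simp only [ContinuousLinearMap.coe_id', id_eq] at hlap
  rw [integral_mul_laplacianAlong b isOpen_univ hsmooth hh hc (Set.subset_univ _)]
  have hscale := Measure.integral_comp_smul (volume : Measure E)
    (fun x => laplacianAlong b (fun p => (‖p‖ ^ 2 + ε ^ 2) ^ ((2 - M) / 2)) x * h x) ε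
  have hεM : 0 < ε ^ Module.finrank ℝ E := by positivity
  rw [abs_of_pos (by positivity), smul_eq_mul, eq_inv_mul_iff_mul_eq₀ hεM.ne'] at hscale
  rw [← hscale, ← integral_const_mul, ← integral_const_mul]
  refine integral_congr_ae (.of_forall fun z => ?_)
  have hnorm : ‖ε • z‖ ^ 2 + ε ^ 2 = ε ^ 2 * (1 + ‖z‖ ^ 2) := by
    rw [norm_smul, Real.norm_eq_abs, mul_pow, sq_abs]; ring
  have hpow : (ε ^ 2 * (1 + ‖z‖ ^ 2)) ^ ((2 - M) / 2 - 2)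
      = (ε ^ Module.finrank ℝ E)⁻¹ * (ε ^ 2)⁻¹ * (1 + ‖z‖ ^ 2) ^ (-(M + 2) / 2) := by
    rw [Real.mul_rpow (by positivity) (by positivity), show (2 - M) / 2 - 2 = -(M + 2) / 2 by ring,
      ← Real.rpow_natCast ε 2, ← Real.rpow_mul hε.le, ← Real.rpow_natCast ε, ← hM,
      ← Real.rpow_neg hε.le, ← Real.rpow_neg hε.le, ← Real.rpow_add hε]
    congr 2
    push_cast; ring
  beta_reduce
  rw [hlap, hnorm, hpow, ← hM]
  field_simp
  ring

lemma locallyIntegrable_norm_rpow (hE : 1 ≤ Module.finrank ℝ E) {s : ℝ} (hs : -dimE < s) :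
    LocallyIntegrable fun x : E => ‖x‖ ^ s :=
  locallyIntegrable_of_norm_le_rpow (C := 1) (α := -s) hE (by linarith)
    (.of_forall fun x => by rw [neg_neg, one_mul, Real.norm_of_nonneg (by positivity)])
    (Measurable.aestronglyMeasurable (by fun_prop))

lemma tendsto_integral_norm_sq_add_sq_rpow_mul (hE : 1 ≤ Module.finrank ℝ E) {s : ℝ} (hs : s ≤ 0)
    (hs' : -dimE < s) (hh : Continuous h) (hc : HasCompactSupport h) :
    Tendsto (fun ε : ℝ => ∫ x : E, (‖x‖ ^ 2 + ε ^ 2) ^ (s / 2) * h x) (𝓝 0)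
      (𝓝 (∫ x : E, ‖x‖ ^ s * h x)) := by
  have : Nontrivial E := Module.nontrivial_of_finrank_pos (R := ℝ) hE
  have hne : ∀ᵐ x : E, x ≠ 0 := Measure.ae_ne volume 0
  have hint : Integrable fun x : E => ‖x‖ ^ s * ‖h x‖ := by
    simpa only [smul_eq_mul, mul_comm] using (locallyIntegrable_norm_rpow hE
      hs').integrable_smul_left_of_hasCompactSupport hh.norm hc.norm
  refine tendsto_integral_filter_of_dominated_convergence _ (.of_forall fun ε => ?_)
    (.of_forall fun ε => ?_) hint ?_
  · exact (Measurable.mul (by fun_prop) hh.measurable).aestronglyMeasurable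
  · filter_upwards [hne] with x hx
    have : 0 < ‖x‖ := norm_pos_iff.mpr hx
    rw [norm_mul, Real.norm_of_nonneg (by positivity), norm_rpow_eq_norm_sq_add_zero_rpow]
    exact mul_le_mul_of_nonneg_right (Real.rpow_le_rpow_of_nonpos (by positivity)
      (by nlinarith [sq_nonneg ε]) (by linarith)) (norm_nonneg _)
  · filter_upwards [hne] with x hx
    have : 0 < ‖x‖ := norm_pos_iff.mpr hx
    rw [norm_rpow_eq_norm_sq_add_zero_rpow]
    refine (Tendsto.rpow_const ?_ (Or.inl (by positivity))).mul_const _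
    simpa using ((tendsto_id (x := 𝓝 (0 : ℝ))).pow 2).const_add (‖x‖ ^ 2)

/- In the regularized kernel `(‖x‖ ^ 2 + ε ^ 2) ^ ((2 - dim E) / 2)`, scaling out `ε` shows that the
Laplacian concentrates at the origin as `ε → 0`. -/
lemma integral_norm_rpow_mul_laplacianAlong (hE : 3 ≤ Module.finrank ℝ E)
    (b : OrthonormalBasis (Fin (Module.finrank ℝ E)) ℝ E) (hh : ContDiff ℝ ∞ h)
    (hc : HasCompactSupport h) :
    ∫ x : E, ‖x‖ ^ (2 - dimE) * laplacianAlong b h x = -(newtonConst E * h 0) := by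
  have hE' : (3 : ℝ) ≤ dimE := by exact_mod_cast hE
  have hregularized := (tendsto_integral_norm_sq_add_sq_rpow_mul (s := 2 - dimE) (by omega)
    (by linarith) (by linarith) (contDiff_laplacianAlong b hh).continuous
    (hasCompactSupport_laplacianAlong b hc)).mono_left (nhdsWithin_le_nhds (s := Set.Ioi 0))
  have hconcentrating := ((tendsto_integral_mul_comp_smul
    (integrable_rpow_neg_one_add_norm_sq (μ := volume) (r := dimE + 2) (by linarith))
    hh.continuous hc).const_mul (-((dimE - 2) * dimE))).mono_left
    (nhdsWithin_le_nhds (s := Set.Ioi 0))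
  have hlim := tendsto_nhds_unique (hregularized.congr' <| by
    filter_upwards [self_mem_nhdsWithin] with ε hε using
      integral_norm_sq_add_sq_rpow_mul_laplacianAlong b hh hc hε) hconcentrating
  rw [hlim, newtonConst]
  ring

lemma integral_norm_sub_rpow_mul_laplacianAlong (hE : 3 ≤ Module.finrank ℝ E)
    (b : OrthonormalBasis (Fin (Module.finrank ℝ E)) ℝ E) (hh : ContDiff ℝ ∞ h)
    (hc : HasCompactSupport h) (y : E) :
    ∫ x : E, ‖x - y‖ ^ (2 - dimE) * laplacianAlong b h x = -(newtonConst E * h y) := by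
  have hshift := integral_norm_rpow_mul_laplacianAlong hE b (h := fun z => h (z + y))
    (hh.comp (contDiff_id.add contDiff_const)) (hc.comp_homeomorph (Homeomorph.addRight y))
  rw [zero_add] at hshift
  rw [← hshift, ← integral_sub_right_eq_self
    (fun x => ‖x‖ ^ (2 - dimE) * laplacianAlong b (fun z => h (z + y)) x) y]
  simp only [laplacianAlong_comp_add_right, sub_add_cancel]

end FundamentalSolution

end Newton

section NewtonPotential

variable {E : Type*} [NormedAddCommGroup E] [InnerProductSpace ℝ E] [FiniteDimensional ℝ E]
  [MeasurableSpace E] [BorelSpace E]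

local notation "dimE" => (Module.finrank ℝ E : ℝ)

section RieszKernels

variable {s t : ℝ} {x : E}

lemma integrableOn_closedBall_zero_norm_sub_rpow_mul_norm_rpow (hs : s ≤ 0) (ht : -dimE < t)
    (hx : x ≠ 0) :
    IntegrableOn (fun y : E => ‖x - y‖ ^ s * ‖y‖ ^ t) (Metric.closedBall 0 (‖x‖ / 2)) := by
  have : Nontrivial E := ⟨x, 0, hx⟩
  have hr : 0 < ‖x‖ / 2 := half_pos (norm_pos_iff.mpr hx)
  refine ((locallyIntegrable_norm_rpow Module.finrank_pos ht |>.integrableOn_isCompact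
    (isCompact_closedBall 0 (‖x‖ / 2))).const_mul ((‖x‖ / 2) ^ s)).mono'
    (Measurable.aestronglyMeasurable (by fun_prop))
    (ae_restrict_of_forall_mem measurableSet_closedBall fun y hy => ?_)
  rw [mem_closedBall_zero_iff] at hy
  rw [Real.norm_of_nonneg (by positivity)]
  exact mul_le_mul_of_nonneg_right (Real.rpow_le_rpow_of_nonpos hr
    (by linarith [norm_sub_norm_le x y]) hs) (by positivity)

lemma integrableOn_closedBall_norm_sub_rpow_mul_norm_rpow (hs : -dimE < s) (ht : t ≤ 0)
    (hx : x ≠ 0) :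
    IntegrableOn (fun y : E => ‖x - y‖ ^ s * ‖y‖ ^ t) (Metric.closedBall x (‖x‖ / 2)) := by
  have hpre : (fun y => x - y) ⁻¹' Metric.closedBall (0 : E) (‖x‖ / 2)
      = Metric.closedBall x (‖x‖ / 2) := by
    ext y
    rw [Set.mem_preimage, mem_closedBall_zero_iff, mem_closedBall_iff_norm']
  have h := ((Measure.measurePreserving_sub_left volume x).integrableOn_comp_preimage
    (Homeomorph.subLeft x).measurableEmbedding).mpr
    (integrableOn_closedBall_zero_norm_sub_rpow_mul_norm_rpow ht hs hx)
  rw [hpre] at h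
  refine h.congr_fun (fun y _ => ?_) measurableSet_closedBall
  simp only [Function.comp_apply, sub_sub_cancel, mul_comm]

lemma integrableOn_compl_norm_sub_rpow_mul_norm_rpow (hs : s ≤ 0) (ht : t ≤ 0)
    (hst : s + t < -dimE) (hx : x ≠ 0) :
    IntegrableOn (fun y : E => ‖x - y‖ ^ s * ‖y‖ ^ t)
      (Metric.closedBall 0 (‖x‖ / 2) ∪ Metric.closedBall x (‖x‖ / 2))ᶜ := by
  set r := ‖x‖ / 2 with hr
  have hr0 : 0 < r := half_pos (norm_pos_iff.mpr hx)
  set c : ℝ := 3 * (1 / r + 1) with hc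
  have hc0 : 0 < c := by positivity
  have hdecay : Integrable fun y : E => (1 + ‖y‖) ^ (s + t) := by
    simpa only [neg_neg] using integrable_one_add_norm (E := E) (r := -(s + t)) (by linarith)
  refine (hdecay.const_mul (c⁻¹ ^ (s + t))).integrableOn.mono'
    (Measurable.aestronglyMeasurable (by fun_prop)) (ae_restrict_of_forall_mem
      (measurableSet_closedBall.union measurableSet_closedBall).compl fun y hy => ?_)
  rw [Set.mem_compl_iff, Set.mem_union, not_or, mem_closedBall_zero_iff, mem_closedBall_iff_norm',
    not_le, not_le] at hy
  have hone : 1 + ‖y‖ ≤ (1 / r + 1) * ‖y‖ := by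
    have : 1 ≤ 1 / r * ‖y‖ := by rw [one_div_mul_eq_div, one_le_div hr0]; exact hy.1.le
    linarith
  have hsub : ‖y‖ ≤ 3 * ‖x - y‖ := by
    linarith [norm_sub_norm_le y x, norm_sub_rev x y, hy.2]
  have hy_lower : c⁻¹ * (1 + ‖y‖) ≤ ‖y‖ := by
    rw [inv_mul_le_iff₀ hc0]
    exact hone.trans (mul_le_mul_of_nonneg_right (by rw [hc]; linarith [one_div_pos.mpr hr0])
      (norm_nonneg y))
  have hxy_lower : c⁻¹ * (1 + ‖y‖) ≤ ‖x - y‖ := by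
    rw [inv_mul_le_iff₀ hc0]
    refine hone.trans ((mul_le_mul_of_nonneg_left hsub (by positivity)).trans_eq ?_)
    rw [hc]
    ring
  have hpos : 0 < c⁻¹ * (1 + ‖y‖) := by positivity
  rw [Real.norm_of_nonneg (by positivity), ← Real.mul_rpow (by positivity) (by positivity),
    Real.rpow_add hpos]
  exact mul_le_mul (Real.rpow_le_rpow_of_nonpos hpos hxy_lower hs)
    (Real.rpow_le_rpow_of_nonpos hpos hy_lower ht) (by positivity) (by positivity)

lemma integrable_norm_sub_rpow_mul_norm_rpow (hs : s ≤ 0) (hs' : -dimE < s) (ht : t ≤ 0)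
    (ht' : -dimE < t) (hst : s + t < -dimE) (hx : x ≠ 0) :
    Integrable fun y : E => ‖x - y‖ ^ s * ‖y‖ ^ t := by
  have h := ((integrableOn_closedBall_zero_norm_sub_rpow_mul_norm_rpow hs ht' hx).union
    (integrableOn_closedBall_norm_sub_rpow_mul_norm_rpow hs' ht hx)).union
    (integrableOn_compl_norm_sub_rpow_mul_norm_rpow hs ht hst hx)
  rwa [Set.union_compl_self, integrableOn_univ] at h

end RieszKernels

section HomogeneousSlices

variable {β : ℝ} {G : ℝ × E → ℝ}

omit [MeasurableSpace E] [BorelSpace E] in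
lemma IsHomog.exists_norm_le_mul_norm_rpow (hG : IsHomog β G) (u : ℝ) :
    ∃ C : ℝ, ∀ y : E, y ≠ 0 → ‖G (u, y)‖ ≤ C * ‖y‖ ^ β := by
  obtain ⟨C, hC⟩ := (isCompact_sphere (0 : E) 1).exists_bound_of_continuousOn
    ((hG.continuousOn_slice u).mono fun y hy => ne_zero_of_mem_unit_sphere ⟨y, hy⟩)
  refine ⟨C, fun y hy => ?_⟩
  rw [hG.eq_norm_rpow_mul u hy, norm_mul, Real.norm_of_nonneg (by positivity), mul_comm]
  exact mul_le_mul_of_nonneg_right (hC _ (inv_norm_smul_mem_sphere hy)) (by positivity)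

lemma IsHomog.aestronglyMeasurable_slice [Nontrivial E] (hG : IsHomog β G) (u : ℝ) :
    AEStronglyMeasurable fun y => G (u, y) := by
  have h := (hG.continuousOn_slice u).aestronglyMeasurable (μ := volume) isOpen_ne.measurableSet
  rwa [Measure.restrict_eq_self_of_ae_mem (s := {y : E | y ≠ 0}) (Measure.ae_ne volume 0)] at h

end HomogeneousSlices

/-- The Newtonian potential in the second variable, up to normalisation. -/
noncomputable def newtonPotential (G : ℝ × E → ℝ) (p : ℝ × E) : ℝ :=
  ∫ y : E, ‖p.2 - y‖ ^ (2 - dimE) * G (p.1, y)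

variable {α : ℝ} {G : ℝ × E → ℝ}

omit [InnerProductSpace ℝ E] [FiniteDimensional ℝ E] [MeasurableSpace E] [BorelSpace E] in
lemma three_le_finrank_of_neg [Module ℝ E] (hα : α < 0) (hα' : 2 - dimE < α) :
    3 ≤ Module.finrank ℝ E := by
  have : (2 : ℝ) < dimE := by linarith
  exact_mod_cast this

lemma integrable_norm_sub_rpow_mul_norm_rpow_sub_two (hα : α < 0) (hα' : 2 - dimE < α) {x : E}
    (hx : x ≠ 0) : Integrable fun y : E => ‖x - y‖ ^ (2 - dimE) * ‖y‖ ^ (α - 2) :=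
  integrable_norm_sub_rpow_mul_norm_rpow (by linarith) (by linarith) (by linarith) (by linarith)
    (by linarith) hx

lemma IsHomog.newtonPotential_similarity [Nontrivial E] (hG : IsHomog (α - 2) G) (u : ℝ) (x : E)
    {r : ℝ} (hr : 0 < r) (R : E ≃ₗᵢ[ℝ] E) :
    newtonPotential G (u, r • R x)
      = r ^ α * ∫ z : E, ‖x - z‖ ^ (2 - dimE) * G (u, R z) := by
  set f : E → ℝ := fun y => ‖r • R x - y‖ ^ (2 - dimE) * G (u, y) with hf
  have hscale := Measure.integral_comp_smul (volume : Measure E) f r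
  have hrE : 0 < r ^ Module.finrank ℝ E := by positivity
  rw [abs_of_pos (by positivity), smul_eq_mul, eq_inv_mul_iff_mul_eq₀ hrE.ne'] at hscale
  have hrotate := R.measurePreserving.integral_comp R.toHomeomorph.measurableEmbedding
    fun y => f (r • y)
  change ∫ y, f y = _
  rw [← hscale, ← hrotate, ← integral_const_mul, ← integral_const_mul]
  refine integral_congr_ae ?_
  filter_upwards [Measure.ae_ne volume (0 : E)] with z hz
  have hpow : r ^ α = r ^ Module.finrank ℝ E * r ^ (2 - dimE) * r ^ (α - 2) := by
    rw [← Real.rpow_natCast, ← Real.rpow_add hr, ← Real.rpow_add hr]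
    congr 1
    ring
  simp only [hf]
  rw [← smul_sub, ← map_sub, norm_smul, R.norm_map, Real.norm_of_nonneg hr.le, hG.homog u _ _
    (EmbeddingLike.map_ne_zero_iff.mpr hz) hr, Real.mul_rpow hr.le (norm_nonneg _), hpow]
  ring

section Smoothness

lemma exists_finite_measure_integral_mul_comp_inv_norm_smul [Nontrivial E] {w : E → ℝ}
    (hw : Integrable w) (hw0 : ∀ y, 0 ≤ w y) (hwm : Measurable w) :
    ∃ μ : Measure E, IsFiniteMeasure μ ∧ ∀ f : E → ℝ, ContinuousOn f (Metric.sphere 0 1) →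
      ∫ y, w y * f (‖y‖⁻¹ • y) = ∫ y in Metric.sphere 0 1, f y ∂μ := by
  set direction : E → E := fun y => ‖y‖⁻¹ • y with hdirection
  have hdirm : Measurable direction := by fun_prop
  set ν : Measure E := volume.withDensity fun y => ENNReal.ofReal (w y) with hν
  have hνfin : IsFiniteMeasure ν := isFiniteMeasure_withDensity_ofReal hw.2
  have hmem : ∀ᵐ y ∂(ν.map direction), y ∈ Metric.sphere (0 : E) 1 := by
    refine (ae_map_iff (p := fun y => y ∈ Metric.sphere (0 : E) 1) hdirm.aemeasurable
      Metric.isClosed_sphere.measurableSet).mpr ((withDensity_absolutelyContinuous _ _).ae_le ?_)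
    filter_upwards [Measure.ae_ne volume (0 : E)] with y hy using inv_norm_smul_mem_sphere hy
  refine ⟨ν.map direction, inferInstance, fun f hf => ?_⟩
  have hfm := hf.aestronglyMeasurable_of_isCompact (μ := ν.map direction) (isCompact_sphere 0 1)
    Metric.isClosed_sphere.measurableSet
  rw [Measure.restrict_eq_self_of_ae_mem hmem] at hfm ⊢
  rw [integral_map hdirm.aemeasurable hfm, hν,
    integral_withDensity_eq_integral_toReal_smul (by fun_prop) (by simp)]
  simp only [ENNReal.toReal_ofReal (hw0 _), smul_eq_mul, hdirection]

lemma IsHomog.exists_newtonPotential_eq_setIntegral_sphere (hα : α < 0) (hα' : 2 - dimE < α)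
    (hG : IsHomog (α - 2) G) {e : E} (he : e ≠ 0) :
    ∃ μ : Measure E, IsFiniteMeasure μ ∧ ∀ u r, 0 < r → ∀ R : E ≃ₗᵢ[ℝ] E,
      newtonPotential G (u, r • R e) = r ^ α * ∫ z in Metric.sphere 0 1, G (u, R z) ∂μ := by
  have : Nontrivial E := ⟨e, 0, he⟩
  obtain ⟨μ, hμ, hint⟩ := exists_finite_measure_integral_mul_comp_inv_norm_smul
    (integrable_norm_sub_rpow_mul_norm_rpow_sub_two hα hα' he) (fun y => by positivity)
    (by fun_prop)
  refine ⟨μ, hμ, fun u r hr R => ?_⟩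
  have hcont : ContinuousOn (fun z => G (u, R z)) (Metric.sphere 0 1) :=
    (hG.continuousOn_slice u).comp R.continuous.continuousOn fun z hz =>
      EmbeddingLike.map_ne_zero_iff.mpr (ne_zero_of_mem_unit_sphere ⟨z, hz⟩)
  rw [hG.newtonPotential_similarity u e hr R, ← hint _ hcont]
  congr 1
  refine integral_congr_ae ?_
  filter_upwards [Measure.ae_ne volume (0 : E)] with z hz
  rw [hG.eq_norm_rpow_mul u (EmbeddingLike.map_ne_zero_iff.mpr hz), R.norm_map, map_smul, mul_assoc]

omit [FiniteDimensional ℝ E] [MeasurableSpace E] [BorelSpace E] in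
lemma reflection_orthogonal_singleton_apply (v z : E) :
    (ℝ ∙ v)ᗮ.reflection z = z - (2 * (inner ℝ v z / ‖v‖ ^ 2)) • v := by
  rw [Submodule.reflection_orthogonal_apply, Submodule.reflection_singleton_apply]
  simp only [RCLike.ofReal_real_eq_id, id_eq, neg_sub, two_smul, two_mul, add_smul]

omit [FiniteDimensional ℝ E] [MeasurableSpace E] [BorelSpace E] in
lemma contDiffOn_reflection_orthogonal_singleton :
    ContDiffOn ℝ ∞ (fun q : E × E => (ℝ ∙ q.1)ᗮ.reflection q.2) {q | q.1 ≠ 0} := by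
  simp only [reflection_orthogonal_singleton_apply]
  exact contDiff_snd.contDiffOn.sub ((contDiffOn_const.mul
    ((contDiff_fst.inner ℝ contDiff_snd).contDiffOn.div (contDiff_fst.norm_sq ℝ).contDiffOn
      fun q hq => pow_ne_zero 2 (norm_ne_zero_iff.mpr hq))).smul contDiff_fst.contDiffOn)

lemma IsHomog.contDiffOn_setIntegral_reflection (hG : IsHomog α G) (μ : Measure E)
    [IsLocallyFiniteMeasure μ] :
    ContDiffOn ℝ ∞ (fun p : ℝ × E => ∫ z in Metric.sphere 0 1,
      G (p.1, (ℝ ∙ p.2)ᗮ.reflection z) ∂μ) (puncturedSpace E) := by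
  set W : Set ((ℝ × E) × E) := {q | q.1.2 ≠ 0} ∩ {q | q.2 ≠ 0}
  have hWo : IsOpen W := (isOpen_ne.preimage (by fun_prop)).inter (isOpen_ne.preimage (by fun_prop))
  have hsmooth : ContDiffOn ℝ ∞
      (fun q : (ℝ × E) × E => G (q.1.1, (ℝ ∙ q.1.2)ᗮ.reflection q.2)) W := by
    have hreflection : ContDiffOn ℝ ∞
        (fun q : (ℝ × E) × E => (ℝ ∙ q.1.2)ᗮ.reflection q.2) W :=
      contDiffOn_reflection_orthogonal_singleton.comp (f := fun q : (ℝ × E) × E => (q.1.2, q.2))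
        (by fun_prop) fun q hq => hq.1
    exact hG.smooth.comp ((contDiff_fst.comp contDiff_fst).contDiffOn.prodMk hreflection)
      fun q hq => EmbeddingLike.map_ne_zero_iff.mpr hq.2
  exact (contDiffOn_setIntegral_of_isCompact (isCompact_sphere 0 1) hWo hsmooth).mono
    fun p hp z hz => ⟨hp, ne_zero_of_mem_unit_sphere ⟨z, hz⟩⟩

-- The singularity of the kernel forbids differentiating under the integral directly. Near a
-- direction `x₀` the rotation invariance of the kernel is used to fix its argument at the antipode
-- `e` of `x₀`, moving all dependence on `x` into the smooth density: the reflection exchanging `e`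
-- with the direction of `x` depends smoothly on `x`, as `e` stays away from it.
lemma IsHomog.contDiffOn_newtonPotential (hα : α < 0) (hα' : 2 - dimE < α)
    (hG : IsHomog (α - 2) G) : ContDiffOn ℝ ∞ (newtonPotential G) (puncturedSpace E) := by
  rintro ⟨u₀, x₀⟩ (hx₀ : x₀ ≠ 0)
  set e : E := -(‖x₀‖⁻¹ • x₀) with he
  have hnorm_dir (x : E) (hx : x ≠ 0) : ‖‖x‖⁻¹ • x‖ = 1 :=
    mem_sphere_zero_iff_norm.mp (inv_norm_smul_mem_sphere hx)
  have he1 : ‖e‖ = 1 := by rw [he, norm_neg, hnorm_dir x₀ hx₀]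
  obtain ⟨μ, hμ, hint⟩ := hG.exists_newtonPotential_eq_setIntegral_sphere hα hα'
    (norm_ne_zero_iff.mp (he1.trans_ne one_ne_zero))
  set axis : ℝ × E → E := fun p => e - ‖p.2‖⁻¹ • p.2 with haxis
  have haxis₀ : axis (u₀, x₀) ≠ 0 := by
    simp only [haxis, he]
    rw [← neg_add', neg_ne_zero, ← two_smul ℝ]
    exact smul_ne_zero two_ne_zero (norm_ne_zero_iff.mp ((hnorm_dir x₀ hx₀).trans_ne one_ne_zero))
  have hnorm : ContDiffAt ℝ ∞ (fun p : ℝ × E => ‖p.2‖) (u₀, x₀) := contDiffAt_snd.norm ℝ hx₀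
  have haxiss : ContDiffAt ℝ ∞ axis (u₀, x₀) :=
    contDiffAt_const.sub ((hnorm.inv (norm_ne_zero_iff.mpr hx₀)).smul contDiffAt_snd)
  have hrhs : ContDiffAt ℝ ∞ (fun p : ℝ × E => ‖p.2‖ ^ α *
      ∫ z in Metric.sphere 0 1, G (p.1, (ℝ ∙ axis p)ᗮ.reflection z) ∂μ) (u₀, x₀) := by
    refine (hnorm.rpow_const_of_ne (norm_ne_zero_iff.mpr hx₀)).mul ?_
    exact ((hG.contDiffOn_setIntegral_reflection μ).contDiffAt
      (isOpen_puncturedSpace.mem_nhds haxis₀)).comp (u₀, x₀) (contDiffAt_fst.prodMk haxiss)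
  refine (hrhs.congr_of_eventuallyEq ?_).contDiffWithinAt
  filter_upwards [isOpen_puncturedSpace.mem_nhds hx₀] with p (hp : p.2 ≠ 0)
  have hpn : 0 < ‖p.2‖ := norm_pos_iff.mpr hp
  have hreflect : (ℝ ∙ axis p)ᗮ.reflection e = ‖p.2‖⁻¹ • p.2 :=
    Submodule.reflection_sub (he1.trans (hnorm_dir p.2 hp).symm)
  rw [← hint p.1 ‖p.2‖ hpn, hreflect, smul_inv_smul₀ hpn.ne']

end Smoothness

lemma IsHomog.isHomog_newtonPotential (hα : α < 0) (hα' : 2 - dimE < α)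
    (hG : IsHomog (α - 2) G) : IsHomog α (newtonPotential G) where
  smooth := hG.contDiffOn_newtonPotential hα hα'
  homog u y _ hy ht :=
    have : Nontrivial E := ⟨y, 0, hy⟩
    hG.newtonPotential_similarity u y ht (LinearIsometryEquiv.refl ℝ E)

section WeakPoisson

variable {k : E → ℝ}

lemma integrable_prod_norm_sub_rpow_mul_norm_rpow_mul (hα : α < 0) (hα' : 2 - dimE < α)
    (hk : Continuous k) (hc : HasCompactSupport k) (hs : tsupport k ⊆ {x | x ≠ 0}) :
    Integrable fun q : E × E => ‖q.1 - q.2‖ ^ (2 - dimE) * ‖q.2‖ ^ (α - 2) * k q.1 := by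
  have : Nontrivial E := Module.nontrivial_of_finrank_pos
    (R := ℝ) (zero_lt_three.trans_le (three_le_finrank_of_neg hα hα'))
  have hN := (IsHomog.norm_rpow (E := E) (α - 2)).isHomog_newtonPotential hα hα'
  refine (integrable_prod_iff (Measurable.aestronglyMeasurable (by fun_prop))).mpr ⟨?_, ?_⟩
  · filter_upwards [Measure.ae_ne volume (0 : E)] with x hx
    exact (integrable_norm_sub_rpow_mul_norm_rpow_sub_two hα hα' hx).mul_const (k x)
  · refine (integrable_mul_of_tsupport_subset (hN.continuousOn_slice 0) hk hc hs).norm.congr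
      (Eventually.of_forall fun x => ?_)
    have hnonneg (y : E) : 0 ≤ ‖x - y‖ ^ (2 - dimE) * ‖y‖ ^ (α - 2) := by positivity
    simp only [norm_mul _ (k x), Real.norm_of_nonneg (hnonneg _), integral_mul_const,
      newtonPotential, Real.norm_of_nonneg (integral_nonneg hnonneg)]

lemma IsHomog.integrable_prod_norm_sub_rpow_mul_mul (hα : α < 0) (hα' : 2 - dimE < α)
    (hG : IsHomog (α - 2) G) (u : ℝ) (hk : Continuous k) (hc : HasCompactSupport k)
    (hs : tsupport k ⊆ {x | x ≠ 0}) :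
    Integrable fun q : E × E => ‖q.1 - q.2‖ ^ (2 - dimE) * G (u, q.2) * k q.1 := by
  have : Nontrivial E := Module.nontrivial_of_finrank_pos
    (R := ℝ) (zero_lt_three.trans_le (three_le_finrank_of_neg hα hα'))
  obtain ⟨C, hC⟩ := hG.exists_norm_le_mul_norm_rpow u
  refine ((integrable_prod_norm_sub_rpow_mul_norm_rpow_mul hα hα' hk hc hs).norm.const_mul C).mono'
    (((Measurable.aestronglyMeasurable (by fun_prop)).mul
      (hG.aestronglyMeasurable_slice u).comp_snd).mul
      (hk.comp continuous_fst).aestronglyMeasurable) ?_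
  filter_upwards [Measure.quasiMeasurePreserving_snd.ae (Measure.ae_ne volume (0 : E))] with q hq
  simp only [norm_mul, Real.norm_of_nonneg (Real.rpow_nonneg (norm_nonneg _) _)]
  rw [← mul_assoc, mul_left_comm C]
  gcongr
  exact hC q.2 hq

lemma IsHomog.integral_newtonPotential_mul_laplacianAlong (hα : α < 0) (hα' : 2 - dimE < α)
    (hG : IsHomog (α - 2) G) (u : ℝ) (b : OrthonormalBasis (Fin (Module.finrank ℝ E)) ℝ E)
    {h : E → ℝ} (hh : ContDiff ℝ ∞ h) (hc : HasCompactSupport h)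
    (hs : tsupport h ⊆ {x | x ≠ 0}) :
    ∫ x, newtonPotential G (u, x) * laplacianAlong b h x
      = -(newtonConst E * ∫ y, G (u, y) * h y) := by
  have hint := hG.integrable_prod_norm_sub_rpow_mul_mul hα hα' u
    (contDiff_laplacianAlong b hh).continuous (hasCompactSupport_laplacianAlong b hc)
    ((tsupport_laplacianAlong_subset b h).trans hs)
  calc ∫ x, newtonPotential G (u, x) * laplacianAlong b h x
      = ∫ x, ∫ y, ‖x - y‖ ^ (2 - dimE) * G (u, y) * laplacianAlong b h x := by
        simp only [newtonPotential, integral_mul_const]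
    _ = ∫ y, ∫ x, ‖x - y‖ ^ (2 - dimE) * G (u, y) * laplacianAlong b h x :=
        integral_integral_swap hint
    _ = ∫ y, -newtonConst E * (G (u, y) * h y) := by
        congr 1 with y
        simp only [mul_right_comm _ (G (u, y)), integral_mul_const,
          integral_norm_sub_rpow_mul_laplacianAlong (three_le_finrank_of_neg hα hα') b hh hc]
        ring
    _ = -(newtonConst E * ∫ y, G (u, y) * h y) := by rw [integral_const_mul, neg_mul]

lemma IsHomog.integral_fiberLaplacian_mul (hG : IsHomog α G) (u : ℝ) {h : E → ℝ}
    (hh : ContDiff ℝ ∞ h) (hc : HasCompactSupport h) (hs : tsupport h ⊆ {x | x ≠ 0}) :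
    ∫ x, fiberLaplacian G (u, x) * h x
      = ∫ x, G (u, x) * laplacianAlong (stdOrthonormalBasis ℝ E) h x := by
  have hslice : ContDiffOn ℝ ∞ (fun x => G (u, x)) {x : E | x ≠ 0} :=
    hG.smooth.comp (contDiff_const.prodMk contDiff_id).contDiffOn fun x hx => hx
  rw [integral_mul_laplacianAlong _ isOpen_ne hslice hh hc hs]
  congr 1 with x
  by_cases hx : x = 0
  · rw [image_eq_zero_of_notMem_tsupport fun hx' => hs hx' hx, mul_zero, mul_zero]
  · rw [laplacianAlong_slice _ hG.smooth isOpen_puncturedSpace hx, fiberLaplacian]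

lemma IsHomog.fiberLaplacian_newtonPotential (hα : α < 0) (hα' : 2 - dimE < α)
    (hG : IsHomog (α - 2) G) :
    Set.EqOn (fiberLaplacian (newtonPotential G)) (fun p => -(newtonConst E * G p))
      (puncturedSpace E) := by
  rintro ⟨u, x⟩ hx
  have hN := hG.isHomog_newtonPotential hα hα'
  have hΔ := hN.isHomog_fiberLaplacian.continuousOn_slice u
  have hcont : ContinuousOn
      (fun x => fiberLaplacian (newtonPotential G) (u, x) + newtonConst E * G (u, x))
      {x : E | x ≠ 0} := hΔ.add (continuousOn_const.mul (hG.continuousOn_slice u))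
  have hae := isOpen_ne.ae_eq_zero_of_integral_contDiff_smul_eq_zero (μ := volume)
    (hcont.locallyIntegrableOn isOpen_ne.measurableSet) fun h hh hc hs => by
      have hΔint := integrable_mul_of_tsupport_subset (μ := volume) hΔ hh.continuous hc hs
      have hGint := integrable_mul_of_tsupport_subset (μ := volume) (hG.continuousOn_slice u)
        hh.continuous hc hs
      calc ∫ x, h x • (fiberLaplacian (newtonPotential G) (u, x) + newtonConst E * G (u, x))
          = ∫ x, (fiberLaplacian (newtonPotential G) (u, x) * h x
              + newtonConst E * (G (u, x) * h x)) := by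
            congr 1 with x
            rw [smul_eq_mul]
            ring
        _ = 0 := by
            rw [integral_add hΔint (hGint.const_mul _), integral_const_mul,
              hN.integral_fiberLaplacian_mul u hh hc hs,
              hG.integral_newtonPotential_mul_laplacianAlong hα hα' u _ hh hc hs, neg_add_cancel]
  exact eq_neg_of_add_eq_zero_left (Measure.eqOn_open_of_ae_eq
    ((ae_restrict_iff' isOpen_ne.measurableSet).mpr hae) isOpen_ne hcont continuousOn_const hx)

end WeakPoisson

lemma poissonSolvable_of_neg (hα : α < 0) (hα' : 2 - dimE < α) : PoissonSolvable E α := by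
  intro G hG
  refine ⟨_, (hG.isHomog_newtonPotential hα hα').const_mul (-(newtonConst E)⁻¹), fun p hp => ?_⟩
  rw [fiberLaplacian, laplacianAlong_const_mul, ← fiberLaplacian,
    hG.fiberLaplacian_newtonPotential hα hα' hp, neg_mul_neg,
    inv_mul_cancel_left₀ (newtonConst_pos (three_le_finrank_of_neg hα hα')).ne']

lemma harmonicUnique_and_poissonSolvable_nat_sub_half (hE : 4 ≤ Module.finrank ℝ E) (k : ℕ) :
    HarmonicUnique E ((k : ℝ) - 1 / 2) ∧ PoissonSolvable E ((k : ℝ) - 1 / 2) := by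
  have hE' : (4 : ℝ) ≤ dimE := by exact_mod_cast hE
  suffices h : HarmonicUnique E ((k : ℝ) - 3 / 2) ∧ HarmonicUnique E ((k : ℝ) - 1 / 2) ∧
      PoissonSolvable E ((k : ℝ) - 1 / 2) from h.2
  induction k with
  | zero =>
    exact ⟨harmonicUnique_of_neg (by norm_num) (by norm_num; linarith),
      harmonicUnique_of_neg (by norm_num) (by norm_num; linarith),
      poissonSolvable_of_neg (by norm_num) (by norm_num; linarith)⟩
  | succ k ih =>
    obtain ⟨huniq', huniq, hsolv⟩ := ih
    have hα : ((k + 1 : ℕ) : ℝ) - 1 / 2 ≠ 0 := by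
      have := k.cast_nonneg (α := ℝ)
      push_cast
      linarith
    have hα₁ : ((k + 1 : ℕ) : ℝ) - 1 / 2 - 1 = (k : ℝ) - 1 / 2 := by push_cast; ring
    have hα₂ : ((k + 1 : ℕ) : ℝ) - 1 / 2 - 2 = (k : ℝ) - 3 / 2 := by push_cast; ring
    have hα₃ : ((k + 1 : ℕ) : ℝ) - 3 / 2 = (k : ℝ) - 1 / 2 := by push_cast; ring
    exact ⟨hα₃ ▸ huniq, HarmonicUnique.succ (hα₁ ▸ huniq) hα,
      PoissonSolvable.succ (hα₁ ▸ hsolv) (hα₂ ▸ huniq') hα⟩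

end NewtonPotential

section CelestialSphere

/-- The Euclidean space `ℝ^{d-1}` containing the celestial sphere. -/
abbrev AmbientSpace (d : ℕ) : Type := EuclideanSpace ℝ (Fin (d - 2 + 1))

variable {d : ℕ}

lemma fact_finrank_ambientSpace (d : ℕ) :
    Fact (Module.finrank ℝ (AmbientSpace d) = d - 2 + 1) := ⟨finrank_euclideanSpace_fin⟩

lemma finrank_ambientSpace (hd : 2 ≤ d) : (Module.finrank ℝ (AmbientSpace d) : ℝ) = d - 1 := by
  rw [finrank_euclideanSpace_fin]
  push_cast [Nat.cast_sub hd]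
  ring

lemma CelestialSphere.coe_ne_zero (x : CelestialSphere d) : (x : AmbientSpace d) ≠ 0 :=
  ne_zero_of_mem_unit_sphere x

lemma CelestialSphere.norm_coe (x : CelestialSphere d) : ‖(x : AmbientSpace d)‖ = 1 :=
  mem_sphere_zero_iff_norm.mp x.2

lemma radialExtension_of_ne_zero (f : CelestialSphere d → ℝ) {y : AmbientSpace d} (hy : y ≠ 0) :
    radialExtension f y = f ⟨‖y‖⁻¹ • y, inv_norm_smul_mem_sphere hy⟩ := dif_neg hy

lemma radialExtension_coe (f : CelestialSphere d → ℝ) (x : CelestialSphere d) :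
    radialExtension f (x : AmbientSpace d) = f x := by
  rw [radialExtension_of_ne_zero f x.coe_ne_zero]
  congr 1
  ext1
  change ‖(x : AmbientSpace d)‖⁻¹ • (x : AmbientSpace d) = x
  rw [x.norm_coe, inv_one, one_smul]

open Classical in
/-- Radial projection to the sphere, with the value `x₀` at the origin. -/
noncomputable def radialProjection (x₀ : CelestialSphere d) (y : AmbientSpace d) :
    CelestialSphere d :=
  if hy : y = 0 then x₀ else ⟨‖y‖⁻¹ • y, inv_norm_smul_mem_sphere hy⟩

lemma contMDiffAt_radialProjection (x₀ : CelestialSphere d) {y : AmbientSpace d} (hy : y ≠ 0) :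
    ContMDiffAt 𝓘(ℝ, AmbientSpace d) (𝓡 (d - 2)) ∞ (radialProjection x₀) y := by
  let U : TopologicalSpace.Opens (AmbientSpace d) := ⟨{y | y ≠ 0}, isOpen_ne⟩
  have hnormalize : ContMDiff 𝓘(ℝ, AmbientSpace d) 𝓘(ℝ, AmbientSpace d) ∞
      fun z : U => ‖(z : AmbientSpace d)‖⁻¹ • (z : AmbientSpace d) := fun z => by
    refine (contMDiffAt_subtype_iff (U := U)
      (f := fun z : AmbientSpace d => ‖z‖⁻¹ • z)).mpr (ContDiffAt.contMDiffAt ?_)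
    exact ((contDiffAt_id.norm ℝ z.2).inv (norm_ne_zero_iff.mpr z.2)).smul contDiffAt_id
  have := fact_finrank_ambientSpace d
  have hcodRestrict := hnormalize.codRestrict_sphere (n := d - 2) fun z =>
    inv_norm_smul_mem_sphere z.2
  refine (contMDiffAt_subtype_iff (U := U) (x := ⟨y, hy⟩) (f := radialProjection x₀)).mp ?_
  exact (hcodRestrict ⟨y, hy⟩).congr_of_eventuallyEq (Eventually.of_forall fun z => dif_neg z.2)

/-- The extension of a function on `ℝ × S^{d-2}` that is constant along rays. -/
noncomputable def scriExtension (f : ℝ × CelestialSphere d → ℝ) (p : ℝ × AmbientSpace d) : ℝ :=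
  radialExtension (fun x => f (p.1, x)) p.2

lemma scriExtension_coe (f : ScriFunction d) (u : ℝ) (x : CelestialSphere d) :
    scriExtension f (u, (x : AmbientSpace d)) = f (u, x) := radialExtension_coe _ x

lemma contDiffOn_scriExtension (f : ScriFunction d) :
    ContDiffOn ℝ ∞ (scriExtension f) (puncturedSpace (AmbientSpace d)) := by
  rintro ⟨u, y⟩ (hy : y ≠ 0)
  let x₀ : CelestialSphere d := ⟨_, inv_norm_smul_mem_sphere hy⟩
  have hcomp : ContMDiffAt 𝓘(ℝ, ℝ × AmbientSpace d) 𝓘(ℝ, ℝ) ∞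
      (fun p : ℝ × AmbientSpace d => f (p.1, radialProjection x₀ p.2)) (u, y) := by
    refine f.contMDiff.contMDiffAt.comp (u, y) ?_
    exact contDiff_fst.contMDiff.contMDiffAt.prodMk
      ((contMDiffAt_radialProjection x₀ hy).comp (u, y) contDiff_snd.contMDiff.contMDiffAt)
  refine (hcomp.contDiffAt.congr_of_eventuallyEq ?_).contDiffWithinAt
  filter_upwards [isOpen_puncturedSpace.mem_nhds hy] with p (hp : p.2 ≠ 0)
  rw [scriExtension, radialExtension_of_ne_zero _ hp, radialProjection, dif_neg hp]

lemma isHomog_scriExtension (f : ScriFunction d) : IsHomog 0 (scriExtension f) where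
  smooth := contDiffOn_scriExtension f
  homog u y t hy ht := by
    rw [Real.rpow_zero, one_mul, scriExtension, scriExtension,
      radialExtension_of_ne_zero _ (smul_ne_zero ht.ne' hy), radialExtension_of_ne_zero _ hy]
    congr 3
    rw [norm_smul, Real.norm_of_nonneg ht.le, mul_inv, smul_smul, mul_right_comm,
      inv_mul_cancel₀ ht.ne', one_mul]

/-- The restriction to `ℝ × S^{d-2}` of a function smooth on the punctured space. -/
noncomputable def scriRestrict (F : ℝ × AmbientSpace d → ℝ)
    (hF : ContDiffOn ℝ ∞ F (puncturedSpace (AmbientSpace d))) : ScriFunction d :=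
  ⟨fun p => F (p.1, (p.2 : AmbientSpace d)), fun p =>
    have := fact_finrank_ambientSpace d
    ((hF.contDiffAt (isOpen_puncturedSpace.mem_nhds p.2.coe_ne_zero)).contMDiffAt).comp p
      (ContMDiffAt.prodMk_space contMDiffAt_fst
        ((contMDiff_coe_sphere (n := d - 2)).contMDiffAt.comp p contMDiffAt_snd))⟩

lemma scriRestrict_apply {F : ℝ × AmbientSpace d → ℝ}
    (hF : ContDiffOn ℝ ∞ F (puncturedSpace (AmbientSpace d))) (u : ℝ) (x : CelestialSphere d) :
    scriRestrict F hF (u, x) = F (u, (x : AmbientSpace d)) := rfl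

/-- A function on the sphere, regarded as independent of retarded time. -/
noncomputable def SphereFunction.toScri (g : SphereFunction d) : ScriFunction d :=
  ⟨fun p => g p.2, g.contMDiff.comp contMDiff_snd⟩

/-- The restriction of a function on `ℝ × S^{d-2}` to a fixed retarded time. -/
noncomputable def ScriFunction.atTime (f : ScriFunction d) (u : ℝ) : SphereFunction d :=
  ⟨fun x => f (u, x), f.contMDiff.comp (contMDiff_const.prodMk contMDiff_id)⟩

/-- The extension of a function on `ℝ × S^{d-2}` that is homogeneous of degree `α`. -/
noncomputable def homogExtension (α : ℝ) (f : ScriFunction d) (p : ℝ × AmbientSpace d) : ℝ :=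
  ‖p.2‖ ^ α * scriExtension f p

lemma isHomog_homogExtension (α : ℝ) (f : ScriFunction d) : IsHomog α (homogExtension α f) := by
  have h := (IsHomog.norm_rpow (E := AmbientSpace d) α).mul (isHomog_scriExtension f)
  rwa [add_zero] at h

lemma homogExtension_coe (α : ℝ) (f : ScriFunction d) (u : ℝ) (x : CelestialSphere d) :
    homogExtension α f (u, (x : AmbientSpace d)) = f (u, x) := by
  rw [homogExtension, x.norm_coe, Real.one_rpow, one_mul, scriExtension_coe]

lemma eqOn_homogExtension {α : ℝ} {F : ℝ × AmbientSpace d → ℝ} (hF : IsHomog α F)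
    {f : ScriFunction d} (h : ∀ u (x : CelestialSphere d), F (u, (x : AmbientSpace d)) = f (u, x)) :
    Set.EqOn F (homogExtension α f) (puncturedSpace (AmbientSpace d)) :=
  hF.eqOn_of_eqOn_sphere (isHomog_homogExtension α f) fun u x hx =>
    (h u ⟨x, hx⟩).trans (homogExtension_coe α f u ⟨x, hx⟩).symm

end CelestialSphere

section AngularOperator

variable {d : ℕ} {n : ℚ} {α : ℝ}

lemma sphereLaplacian_eq_fiberLaplacian (f : ScriFunction d) (u : ℝ) (x : CelestialSphere d) :
    sphereLaplacian (fun y => f (u, y)) x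
      = fiberLaplacian (scriExtension f) (u, (x : AmbientSpace d)) := by
  have hslice : ContDiffAt ℝ ∞ (fun y : AmbientSpace d => scriExtension f (u, y)) x :=
    ((contDiffOn_scriExtension f).contDiffAt
      (isOpen_puncturedSpace.mem_nhds x.coe_ne_zero)).comp (x : AmbientSpace d)
      (contDiffAt_const.prodMk contDiffAt_id)
  exact (laplacian_eq_laplacianAlong (stdOrthonormalBasis ℝ (AmbientSpace d))
    (hslice.of_le (WithTop.coe_le_coe.mpr le_top))).trans
    (laplacianAlong_slice _ (contDiffOn_scriExtension f) isOpen_puncturedSpace x.coe_ne_zero)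

lemma fiberLaplacian_homogExtension (hd : 2 ≤ d) (α : ℝ) (f : ScriFunction d) (u : ℝ)
    (x : CelestialSphere d) :
    fiberLaplacian (homogExtension α f) (u, (x : AmbientSpace d))
      = sphereLaplacian (fun y => f (u, y)) x + α * (α + d - 3) * f (u, x) := by
  refine ((isHomog_scriExtension f).fiberLaplacian_norm_rpow_mul α x.coe_ne_zero).trans ?_
  simp only [x.norm_coe, Real.one_rpow, scriExtension_coe, sphereLaplacian_eq_fiberLaplacian,
    finrank_ambientSpace hd]
  ring

lemma angularOperator_eq_fiberLaplacian (hd : 2 ≤ d)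
    (hn : (((n - 1) * (n - d + 2) : ℚ) : ℝ) = α * (α + d - 3)) (f : ScriFunction d) (u : ℝ)
    (x : CelestialSphere d) :
    angularOperator d n (fun y => f (u, y)) x
      = fiberLaplacian (homogExtension α f) (u, (x : AmbientSpace d)) := by
  rw [fiberLaplacian_homogExtension hd, angularOperator, hn]

/-- The angular equation is uniquely solvable, smoothly in retarded time. -/
def AngularSolvable (d : ℕ) (n : ℚ) : Prop :=
  ∀ g : ScriFunction d, ∃! f : ScriFunction d,
    ∀ u x, angularOperator d n (fun y => f (u, y)) x = g (u, x)

lemma PoissonSolvable.exists_angularOperator_eq (hs : PoissonSolvable (AmbientSpace d) α)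
    (hd : 2 ≤ d) (hn : (((n - 1) * (n - d + 2) : ℚ) : ℝ) = α * (α + d - 3))
    (g : ScriFunction d) :
    ∃ f : ScriFunction d, ∀ u x, angularOperator d n (fun y => f (u, y)) x = g (u, x) := by
  obtain ⟨F, hF, hΔF⟩ := hs _ (isHomog_homogExtension (α - 2) g)
  refine ⟨scriRestrict F hF.smooth, fun u x => ?_⟩
  rw [angularOperator_eq_fiberLaplacian hd hn, ← homogExtension_coe (α - 2) g,
    ← hΔF x.coe_ne_zero]
  exact (laplacianAlong_congr _ isOpen_puncturedSpace
    (eqOn_homogExtension hF (f := scriRestrict F hF.smooth) fun _ _ => rfl) x.coe_ne_zero).symm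

lemma HarmonicUnique.eq_of_angularOperator_eq (hu : HarmonicUnique (AmbientSpace d) α)
    (hd : 2 ≤ d) (hn : (((n - 1) * (n - d + 2) : ℚ) : ℝ) = α * (α + d - 3))
    {f f' : ScriFunction d} (h : ∀ u x, angularOperator d n (fun y => f (u, y)) x
      = angularOperator d n (fun y => f' (u, y)) x) : f = f' := by
  have hf := isHomog_homogExtension α f
  have hf' := isHomog_homogExtension α f'
  have hΔ : Set.EqOn (fiberLaplacian (homogExtension α f)) (fiberLaplacian (homogExtension α f'))
      (puncturedSpace (AmbientSpace d)) :=
    hf.isHomog_fiberLaplacian.eqOn_of_eqOn_sphere hf'.isHomog_fiberLaplacian fun u x hx => by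
      simpa only [angularOperator_eq_fiberLaplacian hd hn] using h u ⟨x, hx⟩
  have hzero := hu _ (hf.sub hf') fun p hp => by
    rw [fiberLaplacian, laplacianAlong_sub _ hf.smooth hf'.smooth isOpen_puncturedSpace hp]
    exact sub_eq_zero.mpr (hΔ hp)
  ext ⟨u, x⟩
  rw [← homogExtension_coe α f, ← homogExtension_coe α f']
  exact sub_eq_zero.mp (hzero (x := (u, (x : AmbientSpace d))) x.coe_ne_zero)

lemma angularSolvable_of_poissonSolvable (hd : 2 ≤ d)
    (hn : (((n - 1) * (n - d + 2) : ℚ) : ℝ) = α * (α + d - 3))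
    (hu : HarmonicUnique (AmbientSpace d) α) (hs : PoissonSolvable (AmbientSpace d) α) :
    AngularSolvable d n := fun g => by
  obtain ⟨f, hf⟩ := hs.exists_angularOperator_eq hd hn g
  exact ⟨f, hf, fun f' hf' =>
    hu.eq_of_angularOperator_eq hd hn fun u x => (hf' u x).trans (hf u x).symm⟩

lemma AngularSolvable.invertible (h : AngularSolvable d n) : AngularOperatorInvertible d n := by
  intro g
  obtain ⟨f, hf, huniq⟩ := h g.toScri
  refine ⟨f.atTime 0, hf 0, fun f' hf' => ?_⟩
  rw [← huniq f'.toScri fun _ => hf']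
  rfl

lemma angularSolvable_of_mem_Ioo (hd : 2 ≤ d) (hn : n ∈ Set.Ioo 1 ((d : ℚ) - 2)) :
    AngularSolvable d n := by
  have hn₁ : (1 : ℝ) < n := by exact_mod_cast hn.1
  have hn₂ : (n : ℝ) < d - 2 := by exact_mod_cast hn.2
  have hlower : 2 - (Module.finrank ℝ (AmbientSpace d) : ℝ) < 1 - n := by
    rw [finrank_ambientSpace hd]
    linarith
  exact angularSolvable_of_poissonSolvable hd (by push_cast; ring)
    (harmonicUnique_of_neg (by linarith) hlower) (poissonSolvable_of_neg (by linarith) hlower)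

lemma angularSolvable_of_nat_sub_half (hd : 5 ≤ d) (k : ℕ)
    (hn : (n - 1) * (n - d + 2) = ((k : ℚ) - 1 / 2) * (k - 1 / 2 + d - 3)) :
    AngularSolvable d n := by
  obtain ⟨huniq, hsolv⟩ := harmonicUnique_and_poissonSolvable_nat_sub_half
    (E := AmbientSpace d) (by rw [finrank_euclideanSpace_fin]; omega) k
  exact angularSolvable_of_poissonSolvable (by omega) (by rw [hn]; push_cast; ring) huniq hsolv

lemma angularSolvable_int_add_half (hd : 5 ≤ d) (k : ℤ) :
    AngularSolvable d ((k : ℚ) + 1 / 2) := by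
  rcases le_or_gt k 0 with hk | hk
  · refine angularSolvable_of_nat_sub_half hd (1 - k).toNat ?_
    rw [← Int.cast_natCast (1 - k).toNat, Int.toNat_of_nonneg (by omega)]
    push_cast
    ring
  rcases lt_or_ge k (d - 3) with hk' | hk'
  · have hk₁ : (1 : ℚ) ≤ k := by exact_mod_cast hk
    have hk₂ : (k : ℚ) + 1 ≤ d - 3 := by exact_mod_cast hk'
    exact angularSolvable_of_mem_Ioo (by omega) ⟨by linarith, by linarith⟩
  · refine angularSolvable_of_nat_sub_half hd (k - d + 3).toNat ?_
    rw [← Int.cast_natCast (k - d + 3).toNat, Int.toNat_of_nonneg (by omega)]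
    push_cast
    ring

end AngularOperator

section TimeIntegration

variable {E : Type*}

/-- The primitive of `H` in the time variable that vanishes at time `u₀`. -/
noncomputable def timeIntegral (u₀ : ℝ) (H : ℝ × E → ℝ) (p : ℝ × E) : ℝ :=
  ∫ s in u₀..p.1, H (s, p.2)

lemma hasDerivAt_timeIntegral (u₀ : ℝ) {H : ℝ × E → ℝ} {y : E}
    (hH : Continuous fun s => H (s, y)) (u : ℝ) :
    HasDerivAt (fun v => timeIntegral u₀ H (v, y)) (H (u, y)) u :=
  intervalIntegral.integral_hasDerivAt_right (hH.intervalIntegrable _ _)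
    hH.stronglyMeasurable.stronglyMeasurableAtFilter hH.continuousAt

variable [NormedAddCommGroup E] [InnerProductSpace ℝ E] [FiniteDimensional ℝ E]

lemma contDiffOn_timeIntegral (u₀ : ℝ) {H : ℝ × E → ℝ}
    (hH : ContDiffOn ℝ ∞ H (puncturedSpace E)) :
    ContDiffOn ℝ ∞ (timeIntegral u₀ H) (puncturedSpace E) := by
  have hrescaled : ContDiffOn ℝ ∞
      (fun q : (ℝ × E) × ℝ => H (u₀ + (q.1.1 - u₀) * q.2, q.1.2)) {q | q.1.2 ≠ 0} :=
    hH.comp (t := puncturedSpace E) (ContDiff.contDiffOn (by fun_prop)) fun _ hq => hq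
  have hintegral := contDiffOn_setIntegral_of_isCompact (μ := volume)
    (isCompact_Icc (a := (0 : ℝ)) (b := 1)) (isOpen_ne.preimage (by fun_prop)) hrescaled
  have hfactor : ContDiffOn ℝ ∞ (fun p : ℝ × E => p.1 - u₀) (puncturedSpace E) :=
    (contDiff_fst.sub contDiff_const).contDiffOn
  refine (hfactor.mul (hintegral.mono fun p hp q _ => hp)).congr fun p _ => ?_
  rw [integral_Icc_eq_integral_Ioc, ← intervalIntegral.integral_of_le zero_le_one,
    intervalIntegral.mul_integral_comp_add_mul (f := fun s => H (s, p.2)), mul_zero, add_zero,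
    mul_one, add_sub_cancel, timeIntegral]

end TimeIntegration

section TimeDerivative

variable {d : ℕ}

/-- The derivative `∂_u f` of a smooth function on `ℝ × S^{d-2}`, again as a smooth function. -/
noncomputable def ScriFunction.timeDeriv (f : ScriFunction d) : ScriFunction d :=
  scriRestrict _ (contDiffOn_dirDeriv (contDiffOn_scriExtension f) isOpen_puncturedSpace (1, 0))

lemma ScriFunction.hasDerivAt_timeDeriv (f : ScriFunction d) (u : ℝ) (x : CelestialSphere d) :
    HasDerivAt (fun v => f (v, x)) (f.timeDeriv (u, x)) u := by
  have hF : DifferentiableAt ℝ (scriExtension f) (u, (x : AmbientSpace d)) :=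
    (isHomog_scriExtension f).differentiableAt x.coe_ne_zero
  have hslice : DifferentiableAt ℝ (fun v => scriExtension f (v, (x : AmbientSpace d))) u :=
    hF.comp (f := fun v => (v, (x : AmbientSpace d))) u (by fun_prop)
  rw [ScriFunction.timeDeriv, scriRestrict_apply, ← deriv_slice hF]
  simpa only [scriExtension_coe] using hslice.hasDerivAt

lemma ScriFunction.timeDeriv_eq_iff {f g : ScriFunction d} :
    f.timeDeriv = g ↔ ∀ u x, deriv (fun v => f (v, x)) u = g (u, x) := by
  simp only [DFunLike.ext_iff, Prod.forall, (f.hasDerivAt_timeDeriv _ _).deriv]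

lemma ScriFunction.eq_of_timeDeriv_eq {f g : ScriFunction d} {u₀ : ℝ}
    (hderiv : f.timeDeriv = g.timeDeriv) (hinit : ∀ x, f (u₀, x) = g (u₀, x)) : f = g := by
  ext ⟨u, x⟩
  have hconst : ∀ v, HasDerivAt (fun v => f (v, x) - g (v, x)) 0 v := fun v => by
    simpa only [hderiv, sub_self] using
      (f.hasDerivAt_timeDeriv v x).fun_sub (g.hasDerivAt_timeDeriv v x)
  have hdiff := is_const_of_deriv_eq_zero (fun v => (hconst v).differentiableAt)
    (fun v => (hconst v).deriv) u u₀
  rwa [hinit, sub_self, sub_eq_zero] at hdiff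

lemma ScriFunction.existsUnique_timeDeriv_eq (g : ScriFunction d) (u₀ : ℝ)
    (init : SphereFunction d) :
    ∃! f : ScriFunction d, f.timeDeriv = g ∧ ∀ x, f (u₀, x) = init x := by
  have hG := contDiffOn_scriExtension g
  let f : ScriFunction d := init.toScri + scriRestrict _ (contDiffOn_timeIntegral u₀ hG)
  have hderiv : f.timeDeriv = g := timeDeriv_eq_iff.mpr fun u x => by
    have hcont : Continuous fun s => scriExtension g (s, (x : AmbientSpace d)) :=
      continuousOn_univ.mp (hG.continuousOn.comp (by fun_prop) fun _ _ => x.coe_ne_zero)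
    rw [← scriExtension_coe g]
    exact ((hasDerivAt_timeIntegral u₀ hcont u).const_add (init x)).deriv
  have hinit : ∀ x, f (u₀, x) = init x := fun x => by
    change init x + ∫ s in u₀..u₀, scriExtension g (s, (x : AmbientSpace d)) = init x
    rw [intervalIntegral.integral_same, add_zero]
  exact ⟨f, ⟨hderiv, hinit⟩, fun f' hf' =>
    eq_of_timeDeriv_eq (hf'.1.trans hderiv.symm) fun x => (hf'.2 x).trans (hinit x).symm⟩

end TimeDerivative

section RecursionStep

variable {d : ℕ} {n : ℚ}

lemma exists_eq_angularOperator (n : ℚ) (f : ScriFunction d) :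
    ∃ g : ScriFunction d, ∀ u x, g (u, x) = angularOperator d n (fun y => f (u, y)) x := by
  have hΔ := (isHomog_scriExtension f).isHomog_fiberLaplacian.smooth
  refine ⟨scriRestrict _ hΔ + (((n - 1) * (n - d + 2) : ℚ) : ℝ) • f, fun u x => ?_⟩
  rw [angularOperator, sphereLaplacian_eq_fiberLaplacian]
  rfl

/-- The recursion relation at order `n` between the coefficients `prev` at order `n - 1` and
`next` at order `n`, with source coefficient `src`. -/
def RecursionStep (n : ℚ) (prev next src : ScriFunction d) : Prop :=
  ∀ (u : ℝ) (x : CelestialSphere d), angularOperator d n (fun y => prev (u, y)) x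
    + ((2 * n - d + 2 : ℚ) : ℝ) * deriv (fun v : ℝ => next (v, x)) u = src (u, x)

lemma AngularSolvable.existsUnique_prev (h : AngularSolvable d n) (next src : ScriFunction d) :
    ∃! prev, RecursionStep n prev next src := by
  refine (existsUnique_congr fun prev => forall₂_congr fun u x => ?_).mp
    (h (src - ((2 * n - d + 2 : ℚ) : ℝ) • next.timeDeriv))
  rw [(next.hasDerivAt_timeDeriv u x).deriv]
  exact eq_sub_iff_add_eq

lemma existsUnique_next (hn : 2 * n - d + 2 ≠ 0) (prev src : ScriFunction d) (u₀ : ℝ)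
    (init : SphereFunction d) :
    ∃! next, RecursionStep n prev next src ∧ ∀ x, next (u₀, x) = init x := by
  have hκ : ((2 * n - d + 2 : ℚ) : ℝ) ≠ 0 := by exact_mod_cast hn
  obtain ⟨A, hA⟩ := exists_eq_angularOperator n prev
  refine (existsUnique_congr fun next => and_congr_left' ?_).mp
    (ScriFunction.existsUnique_timeDeriv_eq (((2 * n - d + 2 : ℚ) : ℝ)⁻¹ • (src - A)) u₀ init)
  rw [ScriFunction.timeDeriv_eq_iff]
  refine forall₂_congr fun u x => ?_
  rw [← hA, ← eq_sub_iff_add_eq', ← eq_inv_mul_iff_mul_eq₀ hκ]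
  rfl

lemma angularOperator_zero (n : ℚ) (x : CelestialSphere d) :
    angularOperator d n (fun _ => 0) x = 0 := by
  have hext : radialExtension (fun _ : CelestialSphere d => (0 : ℝ)) = fun _ => 0 := by
    ext y
    simp [radialExtension]
  simp [angularOperator, sphereLaplacian, hext]

end RecursionStep

section Sequences

variable {X : Type*}

lemma existsUnique_sequence_of_zero (R : ℕ → X → X → Prop) (I : ℕ → X → Prop) (ψ : X)
    (up : ∀ j prev, ∃! next, R j prev next ∧ I (j + 1) next) :
    ∃! a : ℕ → X, (∀ j, R j (a j) (a (j + 1))) ∧ a 0 = ψ ∧ ∀ j, 0 < j → I j (a j) := by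
  choose next hnext hnext_unique using up
  refine ⟨fun j => Nat.rec ψ next j, ⟨fun j => (hnext j _).1, rfl, fun j hj => ?_⟩, ?_⟩
  · obtain ⟨i, rfl⟩ := Nat.exists_eq_succ_of_ne_zero hj.ne'
    exact (hnext i _).2
  · rintro a ⟨hstep, hzero, hinit⟩
    ext j
    induction j with
    | zero => exact hzero
    | succ j ih => rw [hnext_unique j (a j) _ ⟨hstep j, hinit _ j.succ_pos⟩, ih]

lemma existsUnique_sequence (R : ℕ → X → X → Prop) (I : ℕ → X → Prop) (j₀ : ℕ) (ψ : X)
    (down : ∀ j < j₀, ∀ next, ∃! prev, R j prev next)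
    (up : ∀ j, j₀ ≤ j → ∀ prev, ∃! next, R j prev next ∧ I (j + 1) next) :
    ∃! a : ℕ → X, (∀ j, R j (a j) (a (j + 1))) ∧ a j₀ = ψ ∧ ∀ j, j₀ < j → I j (a j) := by
  induction j₀ generalizing R I with
  | zero => exact existsUnique_sequence_of_zero R I ψ fun j => up j j.zero_le
  | succ j₀ ih =>
    obtain ⟨a, ⟨hstep, hj₀, hinit⟩, ha_unique⟩ := ih (fun j => R (j + 1)) (fun j => I (j + 1))
      (fun j hj => down _ (by omega)) (fun j hj => up _ (by omega))
    obtain ⟨p, hp, hp_unique⟩ := down 0 j₀.succ_pos (a 0)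
    refine ⟨fun j => Nat.casesOn j p a, ⟨fun j => ?_, hj₀, fun j hj => ?_⟩, ?_⟩
    · cases j with
      | zero => exact hp
      | succ j => exact hstep j
    · cases j with
      | zero => omega
      | succ j => exact hinit j (by omega)
    · rintro b ⟨hb_step, hb_j₀, hb_init⟩
      have htail := congrFun (ha_unique (fun j => b (j + 1))
        ⟨fun j => hb_step (j + 1), hb_j₀, fun j hj => hb_init _ (by omega)⟩)
      ext j
      cases j with
      | zero => exact hp_unique _ (htail 0 ▸ hb_step 0)
      | succ j => exact htail j

lemma existsUnique_of_sequence [Zero X] (β : ℚ) {P : (ℕ → X) → Prop} (h : ∃! a, P a) :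
    ∃! φ : ℚ → X, (∀ n, (¬∃ j : ℕ, n = β + j) → φ n = 0) ∧ P fun j => φ (β + j) := by
  obtain ⟨a, ha, ha_unique⟩ := h
  have hinj : Function.Injective fun j : ℕ => β + (j : ℚ) :=
    (add_right_injective β).comp Nat.cast_injective
  refine ⟨Function.extend (fun j : ℕ => β + (j : ℚ)) a 0, ⟨fun n hn => ?_, ?_⟩, ?_⟩
  · exact Function.extend_apply' _ _ _ fun ⟨j, hj⟩ => hn ⟨j, hj.symm⟩
  · simpa only [hinj.extend_apply] using ha
  · rintro φ ⟨hzero, hP⟩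
    ext n
    by_cases hn : ∃ j : ℕ, n = β + j
    · obtain ⟨j, rfl⟩ := hn
      exact (congrFun (ha_unique _ hP) j).trans (hinj.extend_apply a 0 j).symm
    · rw [hzero n hn, Function.extend_apply' _ _ _ fun ⟨j, hj⟩ => hn ⟨j, hj.symm⟩, Pi.zero_apply]

end Sequences

section Expansions

variable {d : ℕ}

lemma existsUnique_recursion {β : ℚ} (hβ : (d : ℚ) / 2 - 2 < β) (σ : ℚ → ScriFunction d) (j₀ : ℕ)
    (hang : ∀ j < j₀, AngularSolvable d (β + j + 1)) (u₀ : ℝ) (ψ : ScriFunction d)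
    (φ₀ : ℚ → SphereFunction d) :
    ∃! φ : ℚ → ScriFunction d,
      (∀ n, (¬∃ j : ℕ, n = β + j) → φ n = 0) ∧
      (∀ j : ℕ, RecursionAt φ σ (β + j + 1)) ∧
      φ (β + j₀) = ψ ∧
      (∀ j : ℕ, j₀ < j → ∀ x, φ (β + j) (u₀, x) = φ₀ (β + j) x) := by
  have hseq := existsUnique_of_sequence β <| existsUnique_sequence
    (fun j prev next => RecursionStep (β + j + 1) prev next (σ (β + j + 1 + 1)))
    (fun j φj => ∀ x, φj (u₀, x) = φ₀ (β + j) x) j₀ ψ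
    (fun j hj next => (hang j hj).existsUnique_prev next _)
    (fun j _ prev => existsUnique_next
      (by have : (0 : ℚ) ≤ j := j.cast_nonneg
          linarith) prev _ u₀ _)
  refine (existsUnique_congr fun φ => and_congr_right' (and_congr_left' ?_)).mp hseq
  refine forall_congr' fun j => ?_
  simp only [RecursionAt, RecursionStep, Nat.cast_succ, ← add_assoc, add_sub_cancel_right]

lemma recursionAt_half_sub_one {φ σ : ℚ → ScriFunction d}
    (hφ : IsExpansion (radiativeOrders d) φ) (hσ : σ ((d : ℚ) / 2) = 0) :
    RecursionAt φ σ ((d : ℚ) / 2 - 1) := by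
  have hprev : φ ((d : ℚ) / 2 - 1 - 1) = 0 := hφ _ fun ⟨j, hj⟩ => by
    have : (0 : ℚ) ≤ j := j.cast_nonneg
    linarith
  have hcoeff : 2 * ((d : ℚ) / 2 - 1) - d + 2 = 0 := by ring
  intro u x
  rw [hprev, hcoeff, sub_add_cancel, hσ, Rat.cast_zero, zero_mul, add_zero]
  exact angularOperator_zero _ x

lemma existsUnique_radiative {σ : ℚ → ScriFunction d} (hσ : σ ((d : ℚ) / 2) = 0) {n₀ : ℚ}
    (hn₀ : n₀ ∈ radiativeOrders d)
    (hang : ∀ n ∈ radiativeOrders d, n < n₀ → AngularSolvable d (n + 1)) (u₀ : ℝ)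
    (ψ : ScriFunction d) (φ₀ : ℚ → SphereFunction d) :
    ∃! φ : ℚ → ScriFunction d,
      IsExpansion (radiativeOrders d) φ ∧
      (∀ n ∈ radiativeOrders d, RecursionAt φ σ n) ∧
      φ n₀ = ψ ∧
      (∀ n ∈ radiativeOrders d, n₀ < n → ∀ x, φ n (u₀, x) = φ₀ n x) := by
  obtain ⟨j₀, rfl⟩ := hn₀
  have horder : ∀ i j : ℕ, (d : ℚ) / 2 - 1 + i < (d : ℚ) / 2 - 1 + j ↔ i < j := fun i j => by
    rw [add_lt_add_iff_left, Nat.cast_lt]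
  refine (existsUnique_congr fun φ => ?_).mp (existsUnique_recursion (by linarith) σ j₀
    (fun j hj => hang _ ⟨j, rfl⟩ ((horder j j₀).mpr hj)) u₀ ψ φ₀)
  refine and_congr_right fun hφ => and_congr ⟨fun h => ?_, fun h j => ?_⟩
    (and_congr_right' ⟨fun h => ?_, fun h j hj => h _ ⟨j, rfl⟩ ((horder j₀ j).mpr hj)⟩)
  · rintro _ ⟨_ | j, rfl⟩
    · simpa using recursionAt_half_sub_one hφ hσ
    · simpa only [Nat.cast_succ, add_assoc] using h j
  · simpa only [Nat.cast_succ, add_assoc] using h _ ⟨j + 1, rfl⟩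
  · rintro _ ⟨j, rfl⟩ hj
    exact h j ((horder j₀ j).mp hj)

lemma mem_coulombicOrders_iff {p : ℚ} :
    p ∈ coulombicOrders d ↔ ∃ j : ℕ, p = (d : ℚ) - 4 + j + 1 :=
  exists_congr fun j => by rw [show (d : ℚ) - 4 + j + 1 = d - 3 + j by ring]

lemma isExpansion_coulombicOrders_iff {φ : ℚ → ScriFunction d} :
    IsExpansion (coulombicOrders d) φ ↔
      (∀ n, (¬∃ j : ℕ, n = (d : ℚ) - 4 + j) → φ n = 0) ∧ φ ((d : ℚ) - 4) = 0 := by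
  refine ⟨fun h => ⟨fun n hn => h n fun hmem => ?_, h _ fun ⟨j, hj⟩ => ?_⟩,
    fun ⟨hout, hbelow⟩ n hn => ?_⟩
  · obtain ⟨j, rfl⟩ := mem_coulombicOrders_iff.mp hmem
    exact hn ⟨j + 1, by rw [Nat.cast_succ, add_assoc]⟩
  · have : (0 : ℚ) ≤ j := j.cast_nonneg
    linarith
  · by_cases hn' : ∃ j : ℕ, n = (d : ℚ) - 4 + j
    · obtain ⟨_ | j, rfl⟩ := hn'
      · simpa using hbelow
      · exact absurd (mem_coulombicOrders_iff.mpr ⟨j, by rw [Nat.cast_succ, add_assoc]⟩) hn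
    · exact hout n hn'

lemma existsUnique_coulombic (hd : 4 < d) (σ : ℚ → ScriFunction d) (u₀ : ℝ)
    (φ₀ : ℚ → SphereFunction d) :
    ∃! φ : ℚ → ScriFunction d,
      IsExpansion (coulombicOrders d) φ ∧
      (∀ p ∈ coulombicOrders d, RecursionAt φ σ p) ∧
      (∀ p ∈ coulombicOrders d, ∀ x, φ p (u₀, x) = φ₀ p x) := by
  have hβ : (d : ℚ) / 2 - 2 < d - 4 := by
    have : (4 : ℚ) < d := by exact_mod_cast hd
    linarith
  refine (existsUnique_congr fun φ => ?_).mp (existsUnique_recursion hβ σ 0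
    (fun j hj => absurd hj j.not_lt_zero) u₀ 0 φ₀)
  rw [isExpansion_coulombicOrders_iff, Nat.cast_zero, add_zero]
  simp only [mem_coulombicOrders_iff]
  constructor
  · rintro ⟨hout, hrec, hbelow, hinit⟩
    refine ⟨⟨hout, hbelow⟩, fun _ ⟨j, hj⟩ => hj ▸ hrec j, ?_⟩
    rintro _ ⟨j, rfl⟩
    simpa only [Nat.cast_succ, add_assoc] using hinit (j + 1) j.succ_pos
  · rintro ⟨⟨hout, hbelow⟩, hrec, hinit⟩
    refine ⟨hout, fun j => hrec _ ⟨j, rfl⟩, hbelow, fun j hj => ?_⟩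
    obtain ⟨i, rfl⟩ := Nat.exists_eq_succ_of_ne_zero hj.ne'
    exact hinit _ ⟨i, by rw [Nat.cast_succ, add_assoc]⟩

lemma sub_three_mem_radiativeOrders_of_even (hd : 4 ≤ d) (heven : Even d) :
    (d : ℚ) - 3 ∈ radiativeOrders d := by
  obtain ⟨m, rfl⟩ := heven
  refine ⟨m - 2, ?_⟩
  push_cast [Nat.cast_sub (show 2 ≤ m by omega)]
  ring

lemma angularSolvable_succ_of_mem_radiativeOrders {n : ℚ} (hn : n ∈ radiativeOrders d)
    (hlt : n < d - 3) : AngularSolvable d (n + 1) := by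
  obtain ⟨j, rfl⟩ := hn
  have : (0 : ℚ) ≤ j := j.cast_nonneg
  have hd : (2 : ℚ) ≤ d := by linarith
  exact angularSolvable_of_mem_Ioo (by exact_mod_cast hd) ⟨by linarith, by linarith⟩

lemma IsExpansion.apply_half_eq_zero {S : ℚ → ScriFunction d}
    (hS : IsExpansion (sourceOrders d) S) (hd : 4 ≤ d) (hS4 : d = 4 → S 2 = 0) :
    S ((d : ℚ) / 2) = 0 := by
  rcases hd.eq_or_lt with rfl | hlt
  · norm_num [hS4]
  · refine hS _ fun ⟨j, hj⟩ => ?_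
    have : (0 : ℚ) ≤ j := j.cast_nonneg
    have : (4 : ℚ) < d := by exact_mod_cast hlt
    linarith

lemma mem_radiativeOrders_iff_of_odd (hodd : Odd d) {n : ℚ} :
    n ∈ radiativeOrders d ↔ (∃ k : ℤ, n = (k : ℚ) + 1 / 2) ∧ (d : ℚ) / 2 - 1 ≤ n := by
  obtain ⟨r, rfl⟩ := hodd
  constructor
  · rintro ⟨j, rfl⟩
    exact ⟨⟨r - 1 + j, by push_cast; ring⟩, le_add_of_nonneg_right j.cast_nonneg⟩
  · rintro ⟨⟨k, rfl⟩, hle⟩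
    have hle' : (r : ℤ) - 1 ≤ k := by
      have : (r : ℚ) - 1 ≤ k := by
        push_cast at hle
        linarith
      exact_mod_cast this
    refine ⟨(k - (r - 1)).toNat, ?_⟩
    rw [← Int.cast_natCast (k - (r - 1)).toNat, Int.toNat_of_nonneg (by omega)]
    push_cast
    ring

lemma angularSolvable_succ_of_mem_radiativeOrders_of_odd (hd : 5 ≤ d) (hodd : Odd d) {n : ℚ}
    (hn : n ∈ radiativeOrders d) : AngularSolvable d (n + 1) := by
  obtain ⟨⟨k, rfl⟩, -⟩ := (mem_radiativeOrders_iff_of_odd hodd).mp hn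
  convert angularSolvable_int_add_half hd (k + 1) using 1
  push_cast
  ring

end Expansions

theorem mainTheorem9 (d : ℕ) (hd : 4 ≤ d)
    (S : ℚ → ScriFunction d) (hS : IsExpansion (sourceOrders d) S)
    (hS4 : d = 4 → S 2 = 0) (u₀ : ℝ) :
    (Even d →
      (∀ n : ℤ, 1 < n → n ≤ (d : ℤ) - 3 → AngularOperatorInvertible d n) ∧
      (∀ (φC : ScriFunction d) (φ₀ : ℚ → SphereFunction d),
        ∃! φ : ℚ → ScriFunction d,
          IsExpansion (radiativeOrders d) φ ∧
          (∀ n ∈ radiativeOrders d, RecursionAt φ S n) ∧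
          φ ((d : ℚ) - 3) = φC ∧
          (∀ n ∈ radiativeOrders d, (d : ℚ) - 3 < n → ∀ x, φ n (u₀, x) = φ₀ n x))) ∧
    (Odd d →
      (∀ k : ℤ, AngularOperatorInvertible d ((k : ℚ) + 1 / 2)) ∧
      (∀ n₀ : ℚ, (∃ k : ℤ, n₀ = (k : ℚ) + 1 / 2) → (d : ℚ) / 2 - 1 ≤ n₀ →
        ∀ (φn₀ : ScriFunction d) (φ₀ φt₀ : ℚ → SphereFunction d),
        ∃! Φ : (ℚ → ScriFunction d) × (ℚ → ScriFunction d),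
          IsExpansion (radiativeOrders d) Φ.1 ∧
          IsExpansion (coulombicOrders d) Φ.2 ∧
          (∀ n ∈ radiativeOrders d, RecursionAt Φ.1 0 n) ∧
          (∀ p ∈ coulombicOrders d, RecursionAt Φ.2 S p) ∧
          Φ.1 n₀ = φn₀ ∧
          (∀ n ∈ radiativeOrders d, n₀ < n → ∀ x, Φ.1 n (u₀, x) = φ₀ n x) ∧
          (∀ p ∈ coulombicOrders d, ∀ x, Φ.2 p (u₀, x) = φt₀ p x))) := by
  refine ⟨fun heven => ⟨fun n hn₁ hn₂ => ?_, fun φC φ₀ => ?_⟩,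
    fun hodd => ⟨fun k => ?_, fun n₀ hn₀ hle φn₀ φ₀ φt₀ => ?_⟩⟩
  · refine (angularSolvable_of_mem_Ioo (by omega) ⟨by exact_mod_cast hn₁, ?_⟩).invertible
    have : (n : ℚ) ≤ d - 3 := by exact_mod_cast hn₂
    linarith
  · exact existsUnique_radiative (hS.apply_half_eq_zero hd hS4)
      (sub_three_mem_radiativeOrders_of_even hd heven)
      (fun _ => angularSolvable_succ_of_mem_radiativeOrders) u₀ φC φ₀
  · have hd' : 5 ≤ d := by grind
    exact (angularSolvable_int_add_half hd' k).invertible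
  · have hd' : 5 ≤ d := by grind
    obtain ⟨φ, ⟨hexp, hrec, hn₀_eq, hinit⟩, hφ_unique⟩ := existsUnique_radiative (σ := 0) rfl
      ((mem_radiativeOrders_iff_of_odd hodd).mpr ⟨hn₀, hle⟩)
      (fun n hn _ => angularSolvable_succ_of_mem_radiativeOrders_of_odd hd' hodd hn) u₀ φn₀ φ₀
    obtain ⟨φt, ⟨htexp, htrec, htinit⟩, hφt_unique⟩ := existsUnique_coulombic hd' S u₀ φt₀
    refine ⟨(φ, φt), ⟨hexp, htexp, hrec, htrec, hn₀_eq, hinit, htinit⟩, ?_⟩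
    rintro ⟨χ, χt⟩ ⟨hχexp, hχtexp, hχrec, hχtrec, hχn₀, hχinit, hχtinit⟩
    exact Prod.ext (hφ_unique χ ⟨hχexp, hχrec, hχn₀, hχinit⟩)
      (hφt_unique χt ⟨hχtexp, hχtrec, hχtinit⟩)
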